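/- Let $n\ge 5$. For $x\in\mathbb R^n$ let $$I(x)=\int_{\mathbb R^n}e^{i(|\xi|^4+\xi\cdot x)}\,d\xi ,$$ understood as an oscillatory integral, i.e. as $\lim_{\varepsilon\to0^+}\int e^{i(|\xi|^4+\xi\cdot x)}\varphi(\varepsilon\xi)\,d\xi$ for every Schwartz function $\varphi$ with $\varphi(0)=1$; this limit exists and does not depend on $\varphi$. Given points $x_1,\dots,x_J\in\mathbb R^n$, put $D(x)=\inf_{1\le j\le J}|x-x_j|$ ($=\infty$ if $J=0$). For a sequence $A=(A_k)_{k\ge0}$ of real numbers and $\mu>0$, let $\chi_\mu:\mathbb R^n\to\mathbb R$ denote any smooth function with $\chi_\mu=1$ where $D\le\mu^{-1}$, $\chi_\mu=0$ where $D\ge2\mu^{-1}$, and $\|D^k\chi_\mu(x)\|\le A_k\mu^k$ for all $x\in\mathbb R^n$ and $k\ge0$, and let $\tilde\chi_\mu=1-\chi_\mu$. For $t'<t_0<t''$ and $y,z\in\mathbb R^n$ define the interaction kernel $$K(t',t'',t_0,y,z)=\frac1{(t_0-t')^{n/4}}\,\frac1{(t''-t_0)^{n/4}}\int_{\mathbb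 R^n} I\Big(\frac{x-y}{(t_0-t')^{1/4}}\Big)\,I\Big(\frac{x-z}{(t''-t_0)^{1/4}}\Big)\,\big(1-\tilde\chi_{\mu_5^3}^2(x)\big)\,dx .$$ There is a constant $c>0$ depending only on $n$, and for every sequence $A$ a constant $C>0$ depending only on $n$ and $A$, such that the following holds. Let $C_0\in\mathbb R$ and $0<\mu_3<\mu_1<1$. Then, for all sufficiently small $\mu_5>0$ (below a threshold, smaller than $\mu_3$, that depends only on $n,A,C_0,\mu_1,\mu_3$), for every $J\le\mu_3^{-C_0}$, all points $x_1,\dots,x_J$, every cutoff $\chi_{\mu_5^3}$ as above, all times with $t'\le t_0-\mu_1^{-1}$ and $t''\ge t_0+\mu_1^{-1}$, and all $y\ne z$ in $\mathbb R^n$, the integral over $x$ defining $K$ converges absolutely and $$|K(t',t'',t_0,y,z)|\le\frac{C}{|t'-t''|^{c}} .$$ In particular $c$ and $C$ do not depend on $\mu_1,\mu_3,\mu_5$, on the number $J$ and the positions of the points, or on $t',t'',t_0,y,z$. -/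

import Mathlib

open Filter Topology MeasureTheory
open scoped ContDiff SchwartzMap ENNReal

noncomputable section

namespace BiharmonicKernel

/-- `n`-dimensional Euclidean space. -/
abbrev E (n : ℕ) : Type := EuclideanSpace ℝ (Fin n)

/-- The oscillatory integral `∫ e^{i Φ(ξ)} dξ` (in general not absolutely convergent) exists and has
the value `a`: for every Schwartz function `φ` with `φ 0 = 1`, the absolutely convergent integrals
`∫ e^{i Φ(ξ)} φ(ε ξ) dξ` tend to `a` as `ε → 0+`. -/
def IsOscillatoryIntegral {n : ℕ} (Φ : E n → ℝ) (a : ℂ) : Prop :=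
  ∀ φ : 𝓢(E n, ℂ), φ 0 = 1 →
    Tendsto (fun ε : ℝ => ∫ ξ : E n, Complex.exp (Complex.I * (Φ ξ : ℂ)) * φ (ε • ξ))
      (𝓝[>] 0) (𝓝 a)

open Classical in
/-- The value of the oscillatory integral `∫ e^{i Φ(ξ)} dξ` (zero if it does not exist). -/
def oscillatoryIntegral {n : ℕ} (Φ : E n → ℝ) : ℂ :=
  if h : ∃ a, IsOscillatoryIntegral Φ a then h.choose else 0

/-- The phase `|ξ|⁴ + ξ · x`. -/
def phase {n : ℕ} (x ξ : E n) : ℝ := ‖ξ‖ ^ 4 + inner ℝ ξ x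

/-- The biharmonic fundamental solution `I(x) = ∫ e^{i (|ξ|⁴ + ξ · x)} dξ` at time one. -/
def fundSol {n : ℕ} (x : E n) : ℂ := oscillatoryIntegral (phase x)

/-- `D(x) = inf_j |x - p_j|`, the distance to the points of concentration (`∞` if there are none). -/
def distToPoints {n J : ℕ} (p : Fin J → E n) (x : E n) : ℝ≥0∞ := ⨅ j, edist x (p j)

/-- `χ` is a smooth cutoff `χ_μ` around the points `p`: it is `1` where `D ≤ μ⁻¹`, it is `0` where
`D ≥ 2 μ⁻¹`, and its derivatives of order `k` are bounded by `A k * μ ^ k`. -/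
structure IsCutoff {n J : ℕ} (A : ℕ → ℝ) (p : Fin J → E n) (μ : ℝ) (χ : E n → ℝ) : Prop where
  smooth : ContDiff ℝ ∞ χ
  eq_one : ∀ x, distToPoints p x ≤ ENNReal.ofReal μ⁻¹ → χ x = 1
  eq_zero : ∀ x, ENNReal.ofReal (2 * μ⁻¹) ≤ distToPoints p x → χ x = 0
  deriv_le : ∀ (k : ℕ) (x : E n), ‖iteratedFDeriv ℝ k χ x‖ ≤ A k * μ ^ k

/-- The complementary cutoff `χ̃ = 1 - χ`. -/
def compl {n : ℕ} (χ : E n → ℝ) (x : E n) : ℝ := 1 - χ x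

/-- The integrand
`I((x-y)/(t₀-t')^{1/4}) I((x-z)/(t''-t₀)^{1/4}) (1 - χ̃²(x))` of the interaction kernel. -/
def kernelIntegrand {n : ℕ} (χ : E n → ℝ) (t' t'' t₀ : ℝ) (y z x : E n) : ℂ :=
  fundSol (((t₀ - t') ^ (1 / 4 : ℝ))⁻¹ • (x - y)) *
    fundSol (((t'' - t₀) ^ (1 / 4 : ℝ))⁻¹ • (x - z)) *
    ((1 - compl χ x ^ 2 : ℝ) : ℂ)

/-- The interaction kernel `K(t', t'', t₀, y, z)`. -/
def kernel {n : ℕ} (χ : E n → ℝ) (t' t'' t₀ : ℝ) (y z : E n) : ℂ :=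
  ((1 / (t₀ - t') ^ ((n : ℝ) / 4) : ℝ) : ℂ) * ((1 / (t'' - t₀) ^ ((n : ℝ) / 4) : ℝ) : ℂ) *
    ∫ x : E n, kernelIntegrand χ t' t'' t₀ y z x

end BiharmonicKernel

end

/-! Write `A = t₀ - t'`, `B = t'' - t₀`, `T = A + B = |t' - t''|`, and let `w = 1 - χ̃²`, a bounded
smooth weight supported in `J` balls of radius `2/μ` with `μ = μ₅³`. Damping the phase by replacing
`i` with `i(1 + iδ)` makes every integral absolutely convergent; all bounds are uniform in `δ ∈ (0,
1]` and pass to the limit.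

On the Fourier side (`integral_osc_mul_osc_mul`) the damped kernel is the integral over `k` of `ŵ(k)
e^{-i k·z} osc A B δ k (z - y)`, where `osc` has the convex phase `A|ξ|⁴ + B|ξ - k|⁴` plus a linear
term. Three facts are used:

`exists_norm_osc_le`: `osc` is `O(T^{-n/4})` uniformly in `k` and the linear term. Instead of
stationary phase, the contour is rotated about the critical point `q`, `ξ = q + (1 + i/10)h`.
Criticality cancels the terms linear in `h`, and the remaining real part is at most `-(T|h|⁴ +
B|p|²|h|²)/20`, where `p = q - k` (`norm_cexp_cphase_le`).

`exists_norm_osc_sub_le`: `osc` changes by `O(B|k|)` between `0` and `k`, by the same rotation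
applied to its derivative.

`exists_integral_charTransform_le`: the `L¹` norms of `ŵ` and `|k|ŵ` are `O(J)` and `O(Jμ)`.

Taking absolute values gives `|K| ≲ J T^{-n/4}`. Freezing `k = 0` in `osc` and inverting the Fourier
transform, which leaves the bounded number `w(z)`, gives `|K| ≲ T^{-n/4} + T J μ`
(`exists_norm_integral_osc_mul_osc_le`). If `J ≤ T^{n/8}` the first bound is `O(T^{-n/8})`.
Otherwise `T` is at most `J²`, and the second bound is `O(T^{-n/8})` because `J⁴μ ≤ 1` once `μ₅` is
small. Hence `c = n/8` (`min_bound_le`).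

The same rotation represents `I` by an absolutely convergent integral, from which existence,
continuity and boundedness of `I` follow. -/

namespace BiharmonicKernel

/-! ### Rotating the contour of integration -/

/-- Differentiation under the integral sign for a holomorphic family dominated near a point. -/
theorem differentiableAt_integral_of_dominated {n : ℕ} {f : ℂ → E n → ℂ} {z₀ : ℂ} {r : ℝ}
    (hr : 0 < r) {g : E n → ℝ} (hg : Integrable g)
    (hd : ∀ h, Differentiable ℂ fun z => f z h) (hc : Continuous fun p : ℂ × E n => f p.1 p.2)
    (hb : ∀ z ∈ Metric.ball z₀ r, ∀ h, ‖f z h‖ ≤ g h) :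
    DifferentiableAt ℂ (fun z => ∫ h, f z h) z₀ := by
  have hcz (z : ℂ) : Continuous (f z) := hc.comp (continuous_const.prodMk continuous_id)
  have hm : Measurable fun p : E n × ℂ => deriv (fun z => f z p.1) p.2 :=
    measurable_deriv_with_param (f := fun h z => f z h)
      (hc.comp (continuous_snd.prodMk continuous_fst))
  refine (hasDerivAt_integral_of_dominated_loc_of_deriv_le (F := f)
    (F' := fun z h => deriv (fun z => f z h) z) (bound := fun h => g h / (r / 2))
    (Metric.ball_mem_nhds z₀ (half_pos hr)) (.of_forall fun z => (hcz z).aestronglyMeasurable)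
    (hg.mono' (hcz z₀).aestronglyMeasurable
      (.of_forall fun h => hb z₀ (Metric.mem_ball_self hr) h))
    (hm.comp (measurable_id.prodMk measurable_const)).aestronglyMeasurable
    (.of_forall fun h z hz => ?_) (hg.div_const _)
    (.of_forall fun h z _ => (hd h z).hasDerivAt)).2.differentiableAt
  -- Cauchy's estimate: for `z` within `r / 2` of `z₀` the circle of radius `r / 2` about `z` stays
  -- in the ball where `g` dominates, so no bound on the derivative need be assumed.
  refine Complex.norm_deriv_le_of_forall_mem_sphere_norm_le (half_pos hr) (hd h).diffContOnCl
    fun w hw => hb w ?_ h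
  rw [Metric.mem_ball] at hz ⊢
  rw [Metric.mem_sphere] at hw
  linarith [dist_triangle w z z₀]

/-- If `f` is homogeneous, in the sense that scaling the parameter amounts to scaling the variable,
then `z ^ n * ∫ f z` is locally constant. -/
theorem hasDerivAt_pow_mul_integral {n : ℕ} {f : ℂ → E n → ℂ} {z₀ : ℂ} (hz₀ : z₀ ≠ 0) {r : ℝ}
    (hr : 0 < r) {g : E n → ℝ} (hg : Integrable g)
    (hd : ∀ h, Differentiable ℂ fun z => f z h) (hc : Continuous fun p : ℂ × E n => f p.1 p.2)
    (hb : ∀ z ∈ Metric.ball z₀ r, ∀ h, ‖f z h‖ ≤ g h)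
    (hs : ∀ (t : ℝ) z h, f (t * z) h = f z (t • h)) :
    HasDerivAt (fun z => z ^ n * ∫ h, f z h) 0 z₀ := by
  have hD : DifferentiableAt ℂ (fun z => z ^ n * ∫ h, f z h) z₀ :=
    (differentiableAt_id.pow n).mul (differentiableAt_integral_of_dominated hr hg hd hc hb)
  set F : ℂ → ℂ := fun z => z ^ n * ∫ h, f z h with hF
  have hconst : ∀ t : ℝ, 0 < t → F (t * z₀) = F z₀ := by
    intro t ht
    have h1 : (∫ h, f (t * z₀) h) = ((t ^ n)⁻¹ : ℝ) • ∫ h, f z₀ h := by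
      simp_rw [hs]
      rw [Measure.integral_comp_smul_of_nonneg volume (f z₀) t (hR := ht.le)]
      simp
    have h2 : (t : ℂ) ^ n ≠ 0 := pow_ne_zero _ (by exact_mod_cast ht.ne')
    simp only [hF, h1, mul_pow, Complex.real_smul, Complex.ofReal_inv, Complex.ofReal_pow]
    field_simp
  -- A complex derivative is determined by one real direction. Along the ray through `z₀` the
  -- function is constant, so `deriv F z₀ * z₀ = 0`.
  have hcomp : HasDerivAt (fun t : ℝ => F (t * z₀)) (deriv F z₀ * z₀) 1 := by
    have h1 : HasDerivAt (fun t : ℂ => t * z₀) z₀ ((1 : ℝ) : ℂ) := by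
      simpa using (hasDerivAt_id ((1 : ℝ) : ℂ)).mul_const z₀
    have h2 : HasDerivAt F (deriv F z₀) (((1 : ℝ) : ℂ) * z₀) := by
      simpa using hD.hasDerivAt
    exact (HasDerivAt.comp (h := fun t : ℂ => t * z₀) _ h2 h1).comp_ofReal
  have hzero : HasDerivAt (fun t : ℝ => F (t * z₀)) 0 1 := by
    refine (hasDerivAt_const (1 : ℝ) (F z₀)).congr_of_eventuallyEq ?_
    filter_upwards [lt_mem_nhds (zero_lt_one' ℝ)] with t ht using hconst t ht
  have h0 : deriv F z₀ = 0 := by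
    rcases mul_eq_zero.1 (hcomp.unique hzero) with h | h
    · exact h
    · exact absurd h hz₀
  exact h0 ▸ hD.hasDerivAt

/-- Rotation of the contour from `ℝⁿ` to `(1 + i τ) ℝⁿ`. -/
theorem integral_eq_pow_mul_integral {n : ℕ} {f : ℂ → E n → ℂ} {τ : ℝ} (hτ : 0 ≤ τ)
    (hd : ∀ h, Differentiable ℂ fun z => f z h) (hc : Continuous fun p : ℂ × E n => f p.1 p.2)
    (hb : ∀ σ ∈ Set.Icc 0 τ, ∃ r > 0, ∃ g : E n → ℝ, Integrable g ∧
      ∀ z ∈ Metric.ball (1 + σ * Complex.I) r, ∀ h, ‖f z h‖ ≤ g h)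
    (hs : ∀ (t : ℝ) z h, f (t * z) h = f z (t • h)) :
    ∫ h, f 1 h = (1 + τ * Complex.I) ^ n * ∫ h, f (1 + τ * Complex.I) h := by
  set F : ℂ → ℂ := fun z => z ^ n * ∫ h, f z h with hF
  have hder : ∀ σ ∈ Set.Icc 0 τ, HasDerivAt (fun s : ℝ => F (1 + s * Complex.I)) 0 σ := by
    intro σ hσ
    obtain ⟨r, hr, g, hg, hbd⟩ := hb σ hσ
    have hne : (1 + σ * Complex.I : ℂ) ≠ 0 := by
      intro h
      simpa using congrArg Complex.re h
    have h1 : HasDerivAt (fun s : ℂ => 1 + s * Complex.I) Complex.I (σ : ℂ) := by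
      simpa using ((hasDerivAt_id (σ : ℂ)).mul_const Complex.I).const_add 1
    have h2 := (hasDerivAt_pow_mul_integral hne hr hg hd hc hbd hs).comp (σ : ℂ) h1
    simpa using h2.comp_ofReal
  have := constant_of_has_deriv_right_zero (f := fun s : ℝ => F (1 + s * Complex.I)) (a := 0)
    (b := τ) (fun σ hσ => (hder σ hσ).continuousAt.continuousWithinAt)
    (fun σ hσ => (hder σ (Set.Ico_subset_Icc_self hσ)).hasDerivWithinAt) τ ⟨hτ, le_rfl⟩
  simpa [hF] using this.symm

/-! ### The complexified phase -/

/-- The holomorphic extension in `z` of `‖q + z h‖²`. -/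
noncomputable def csq {n : ℕ} (q h : E n) (z : ℂ) : ℂ :=
  (‖q‖ : ℂ) ^ 2 + 2 * z * (inner ℝ q h : ℝ) + z ^ 2 * (‖h‖ : ℂ) ^ 2

/-- The holomorphic extension in `z` of
`w (A ‖q + z h‖⁴ + B ‖p + z h‖⁴) + i ⟪q + z h, v⟫`. -/
noncomputable def cphase {n : ℕ} (w : ℂ) (A B : ℝ) (q p v h : E n) (z : ℂ) : ℂ :=
  w * (A * csq q h z ^ 2 + B * csq p h z ^ 2) +
    Complex.I * ((inner ℝ q v : ℝ) + z * (inner ℝ h v : ℝ))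

theorem csq_one {n : ℕ} (q h : E n) : csq q h 1 = ((‖q + h‖ ^ 2 : ℝ) : ℂ) := by
  rw [csq, norm_add_sq_real]
  push_cast
  ring

theorem csq_mul {n : ℕ} (q h : E n) (t : ℝ) (z : ℂ) : csq q h (t * z) = csq q (t • h) z := by
  have : ((‖t • h‖ : ℝ) : ℂ) ^ 2 = (t : ℂ) ^ 2 * (‖h‖ : ℂ) ^ 2 := by
    rw [← Complex.ofReal_pow, norm_smul, mul_pow, Real.norm_eq_abs, sq_abs]
    push_cast
    rfl
  rw [csq, csq, this, inner_smul_right]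
  push_cast
  ring

theorem cphase_mul {n : ℕ} (w : ℂ) (A B : ℝ) (q p v h : E n) (t : ℝ) (z : ℂ) :
    cphase w A B q p v h (t * z) = cphase w A B q p v (t • h) z := by
  rw [cphase, cphase, csq_mul, csq_mul, real_inner_smul_left]
  push_cast
  ring

theorem differentiable_csq {n : ℕ} (q h : E n) : Differentiable ℂ (csq q h) := by
  unfold csq
  fun_prop

theorem differentiable_cphase {n : ℕ} (w : ℂ) (A B : ℝ) (q p v h : E n) :
    Differentiable ℂ (cphase w A B q p v h) := by
  have h1 := differentiable_csq q h
  have h2 := differentiable_csq p h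
  unfold cphase
  fun_prop

@[fun_prop]
theorem continuous_csq {n : ℕ} {X : Type*} [TopologicalSpace X] {q h : X → E n} {z : X → ℂ}
    (hq : Continuous q) (hh : Continuous h) (hz : Continuous z) :
    Continuous fun x => csq (q x) (h x) (z x) := by
  unfold csq
  fun_prop

@[fun_prop]
theorem continuous_cphase {n : ℕ} {X : Type*} [TopologicalSpace X] {w : X → ℂ} {A B : X → ℝ}
    {q p v h : X → E n} {z : X → ℂ} (hw : Continuous w) (hA : Continuous A) (hB : Continuous B)
    (hq : Continuous q) (hp : Continuous p) (hv : Continuous v) (hh : Continuous h)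
    (hz : Continuous z) :
    Continuous fun x => cphase (w x) (A x) (B x) (q x) (p x) (v x) (h x) (z x) := by
  unfold cphase
  fun_prop

theorem norm_csq_le {n : ℕ} (q h : E n) (z : ℂ) : ‖csq q h z‖ ≤ (‖q‖ + ‖z‖ * ‖h‖) ^ 2 := by
  have h1 : ‖((inner ℝ q h : ℝ) : ℂ)‖ ≤ ‖q‖ * ‖h‖ := by
    rw [Complex.norm_real]
    exact norm_inner_le_norm q h
  calc ‖csq q h z‖ ≤ ‖(‖q‖ : ℂ) ^ 2‖ + ‖2 * z * ((inner ℝ q h : ℝ) : ℂ)‖ + ‖z ^ 2 * (‖h‖ : ℂ) ^ 2‖ :=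
        norm_add₃_le
    _ ≤ ‖q‖ ^ 2 + 2 * ‖z‖ * (‖q‖ * ‖h‖) + ‖z‖ ^ 2 * ‖h‖ ^ 2 := by
        simp only [norm_mul, norm_pow, Complex.norm_real, norm_norm, Complex.norm_ofNat]
        rw [Complex.norm_real] at h1
        gcongr
    _ = _ := by ring

theorem norm_csq_sq_sub_le {n : ℕ} (q h : E n) {z : ℂ} (hz : ‖z‖ ≤ 2) :
    ‖csq q h z ^ 2 - z ^ 4 * (‖h‖ : ℂ) ^ 4‖ ≤ 32 * (1 + ‖q‖) ^ 4 * (1 + ‖h‖) ^ 3 := by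
  have hin : ‖((inner ℝ q h : ℝ) : ℂ)‖ ≤ ‖q‖ * ‖h‖ := by
    rw [Complex.norm_real]
    exact norm_inner_le_norm q h
  have hq := norm_nonneg q
  have hh := norm_nonneg h
  have e : csq q h z ^ 2 - z ^ 4 * (‖h‖ : ℂ) ^ 4 =
      ((‖q‖ : ℂ) ^ 2 + 2 * z * (inner ℝ q h : ℝ)) * (csq q h z + z ^ 2 * (‖h‖ : ℂ) ^ 2) := by
    unfold csq
    ring
  have h1 : ‖(‖q‖ : ℂ) ^ 2 + 2 * z * (inner ℝ q h : ℝ)‖ ≤ 4 * (1 + ‖q‖) ^ 2 * (1 + ‖h‖) := by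
    calc _ ≤ ‖(‖q‖ : ℂ) ^ 2‖ + ‖2 * z * ((inner ℝ q h : ℝ) : ℂ)‖ := norm_add_le _ _
      _ ≤ ‖q‖ ^ 2 + 2 * 2 * (‖q‖ * ‖h‖) := by
        rw [norm_mul, norm_mul]
        simp only [norm_pow, Complex.norm_real, norm_norm, Complex.norm_ofNat] at hin ⊢
        gcongr
      _ ≤ _ := by nlinarith [mul_nonneg hq hh, mul_nonneg (sq_nonneg ‖q‖) hh]
  have h2 : ‖csq q h z + z ^ 2 * (‖h‖ : ℂ) ^ 2‖ ≤ 8 * (1 + ‖q‖) ^ 2 * (1 + ‖h‖) ^ 2 := by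
    calc _ ≤ ‖csq q h z‖ + ‖z ^ 2 * (‖h‖ : ℂ) ^ 2‖ := norm_add_le _ _
      _ ≤ (‖q‖ + 2 * ‖h‖) ^ 2 + 2 ^ 2 * ‖h‖ ^ 2 := by
        refine add_le_add ((norm_csq_le q h z).trans (by gcongr)) ?_
        rw [norm_mul]
        simp only [norm_pow, Complex.norm_real, norm_norm]
        gcongr
      _ ≤ _ := by
        have : ‖q‖ + 2 * ‖h‖ ≤ 2 * ((1 + ‖q‖) * (1 + ‖h‖)) := by nlinarith [mul_nonneg hq hh]
        have h3 : (‖q‖ + 2 * ‖h‖) ^ 2 ≤ (2 * ((1 + ‖q‖) * (1 + ‖h‖))) ^ 2 := by gcongr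
        have h4 : ‖h‖ ≤ (1 + ‖q‖) * (1 + ‖h‖) := by nlinarith [mul_nonneg hq hh]
        have h5 : ‖h‖ ^ 2 ≤ ((1 + ‖q‖) * (1 + ‖h‖)) ^ 2 := by gcongr
        nlinarith
  rw [e, norm_mul]
  calc _ ≤ (4 * (1 + ‖q‖) ^ 2 * (1 + ‖h‖)) * (8 * (1 + ‖q‖) ^ 2 * (1 + ‖h‖) ^ 2) := by gcongr
    _ = _ := by ring

/-- The part of the phase quartic in `h` is `w z⁴ (A + B)‖h‖⁴`; everything else grows at most
cubically. Thus the sign of `Re (w z⁴)` alone decides integrability, wherever the contour is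
centred. -/
theorem re_cphase_le {n : ℕ} {w z : ℂ} {A B c : ℝ} (q p v h : E n) (hw : ‖w‖ ≤ 2) (hz : ‖z‖ ≤ 2)
    (hwz : (w * z ^ 4).re ≤ -c) (hA : 0 ≤ A) (hB : 0 ≤ B) :
    (cphase w A B q p v h z).re ≤
      (64 * (A * (1 + ‖q‖) ^ 4 + B * (1 + ‖p‖) ^ 4) + 2 * ‖v‖) * (1 + ‖h‖) ^ 3 -
        c * (A + B) * ‖h‖ ^ 4 := by
  have hh := norm_nonneg h
  set X := csq q h z ^ 2 - z ^ 4 * (‖h‖ : ℂ) ^ 4 with hX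
  set Y := csq p h z ^ 2 - z ^ 4 * (‖h‖ : ℂ) ^ 4 with hY
  have e : cphase w A B q p v h z = (w * z ^ 4) * (((A + B) * ‖h‖ ^ 4 : ℝ) : ℂ) +
      (w * X * (A : ℝ) + w * Y * (B : ℝ)) + z * (Complex.I * (inner ℝ h v : ℝ)) +
      Complex.I * (inner ℝ q v : ℝ) := by
    rw [cphase, hX, hY]
    push_cast
    ring
  have hXn := norm_csq_sq_sub_le q h hz
  have hYn := norm_csq_sq_sub_le p h hz
  have h1 : (w * X * (A : ℝ)).re ≤ 64 * A * (1 + ‖q‖) ^ 4 * (1 + ‖h‖) ^ 3 := by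
    calc _ ≤ ‖w * X * (A : ℝ)‖ := Complex.re_le_norm _
      _ = ‖w‖ * ‖X‖ * A := by
        rw [norm_mul, norm_mul, Complex.norm_real, Real.norm_of_nonneg hA]
      _ ≤ 2 * (32 * (1 + ‖q‖) ^ 4 * (1 + ‖h‖) ^ 3) * A := by gcongr
      _ = _ := by ring
  have h2 : (w * Y * (B : ℝ)).re ≤ 64 * B * (1 + ‖p‖) ^ 4 * (1 + ‖h‖) ^ 3 := by
    calc _ ≤ ‖w * Y * (B : ℝ)‖ := Complex.re_le_norm _
      _ = ‖w‖ * ‖Y‖ * B := by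
        rw [norm_mul, norm_mul, Complex.norm_real, Real.norm_of_nonneg hB]
      _ ≤ 2 * (32 * (1 + ‖p‖) ^ 4 * (1 + ‖h‖) ^ 3) * B := by gcongr
      _ = _ := by ring
  have h3 : (z * (Complex.I * (inner ℝ h v : ℝ))).re ≤ 2 * ‖v‖ * (1 + ‖h‖) ^ 3 := by
    calc _ ≤ ‖z * (Complex.I * (inner ℝ h v : ℝ))‖ := Complex.re_le_norm _
      _ = ‖z‖ * ‖(inner ℝ h v : ℝ)‖ := by
        rw [norm_mul, norm_mul, Complex.norm_I, one_mul, Complex.norm_real]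
      _ ≤ 2 * (‖h‖ * ‖v‖) := by gcongr; exact norm_inner_le_norm h v
      _ = 2 * ‖v‖ * ‖h‖ := by ring
      _ ≤ _ := by
        gcongr
        nlinarith [sq_nonneg ‖h‖, mul_nonneg hh (sq_nonneg ‖h‖)]
  have h4 : ((w * z ^ 4) * (((A + B) * ‖h‖ ^ 4 : ℝ) : ℂ)).re ≤ -c * ((A + B) * ‖h‖ ^ 4) := by
    rw [Complex.re_mul_ofReal]
    exact mul_le_mul_of_nonneg_right hwz (by positivity)
  have h5 : (Complex.I * ((inner ℝ q v : ℝ) : ℂ)).re = 0 := by simp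
  rw [e, Complex.add_re, Complex.add_re, Complex.add_re, Complex.add_re, h5]
  linarith

theorem exists_one_add_pow_mul_exp_le {c K : ℝ} (hc : 0 < c) (hK : 0 ≤ K) :
    ∃ M > 0, ∀ t, 0 ≤ t →
      (1 + t) ^ 3 * Real.exp (K * (1 + t) ^ 3 - c * t ^ 4) ≤ M * Real.exp (-t ^ 2) := by
  -- For `t ≥ 1`, `(1 + t)³ ≤ 8t³`; one unit of `K` absorbs the prefactor and the final `+ 1`
  -- absorbs `t²`. It remains to bound `t³(k - ct)`, which is positive only for `t < k / c`.
  set k := 8 * (K + 1) + 1 with hk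
  have hk0 : 0 < k := by positivity
  refine ⟨Real.exp (k + k * (k / c) ^ 3), Real.exp_pos _, fun t ht => ?_⟩
  have h1 : (1 + t) ^ 3 ≤ Real.exp ((1 + t) ^ 3) := by
    linarith [Real.add_one_le_exp ((1 + t) ^ 3)]
  calc _ ≤ Real.exp ((1 + t) ^ 3) * Real.exp (K * (1 + t) ^ 3 - c * t ^ 4) := by gcongr
    _ = Real.exp ((K + 1) * (1 + t) ^ 3 - c * t ^ 4) := by
      rw [← Real.exp_add]
      ring_nf
    _ ≤ Real.exp (k + k * (k / c) ^ 3 + -t ^ 2) := by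
      apply Real.exp_le_exp.2
      have hkc : 0 ≤ k * (k / c) ^ 3 := by positivity
      rcases le_total t 1 with h | h
      · have h2 : (1 + t) ^ 3 ≤ (1 + 1) ^ 3 := by gcongr
        have h3 : t ^ 2 ≤ 1 := by nlinarith
        have h4 : 0 ≤ c * t ^ 4 := by positivity
        nlinarith
      · have h2 : (1 + t) ^ 3 ≤ (t + t) ^ 3 := by gcongr
        have h3 : t ^ 2 ≤ t ^ 3 := by nlinarith [sq_nonneg t]
        have h4 : (K + 1) * (1 + t) ^ 3 ≤ (K + 1) * (t + t) ^ 3 := by gcongr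
        have h5 : t ^ 3 * (k - c * t) ≤ k * (k / c) ^ 3 := by
          rcases le_total (k / c) t with h6 | h6
          · have : k ≤ c * t := by rwa [div_le_iff₀' hc] at h6
            have : t ^ 3 * (k - c * t) ≤ 0 :=
              mul_nonpos_of_nonneg_of_nonpos (by positivity) (by linarith)
            linarith
          · have h7 : t ^ 3 ≤ (k / c) ^ 3 := by gcongr
            have h8 : 0 ≤ c * t := by positivity
            calc t ^ 3 * (k - c * t) ≤ t ^ 3 * k := by gcongr; linarith
              _ ≤ (k / c) ^ 3 * k := by gcongr
              _ = _ := by ring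
        nlinarith
    _ = _ := Real.exp_add _ _

theorem integrable_exp_neg_mul_norm_sq {n : ℕ} {c : ℝ} (hc : 0 < c) :
    Integrable fun h : E n => Real.exp (-(c * ‖h‖ ^ 2)) := by
  have := (GaussianFourier.integrable_cexp_neg_mul_sq_norm_add (V := E n) (b := (c : ℂ))
    (by simpa using hc) 0 0).norm
  refine this.congr (.of_forall fun h => ?_)
  simp only [Complex.norm_exp]
  congr 1
  simp [← Complex.ofReal_pow]

theorem integrable_exp_neg_norm_sq {n : ℕ} :
    Integrable fun h : E n => Real.exp (-‖h‖ ^ 2) := by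
  simpa using integrable_exp_neg_mul_norm_sq (n := n) one_pos

/-- Uniform domination of the complexified integrands by a Gaussian. -/
theorem exists_norm_mul_cexp_cphase_le {n : ℕ} {A B c : ℝ} (hA : 0 ≤ A) (hB : 0 ≤ B)
    (hAB : 0 < A + B) (hc : 0 < c) (q p : E n) (V : ℝ) (hV : 0 ≤ V) :
    ∃ M > 0, ∀ (w z : ℂ) (v h : E n) (a : ℂ) (L : ℝ), ‖w‖ ≤ 2 → ‖z‖ ≤ 2 → (w * z ^ 4).re ≤ -c →
      ‖v‖ ≤ V → 0 ≤ L → ‖a‖ ≤ L * (1 + ‖h‖) ^ 3 →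
      ‖a * Complex.exp (cphase w A B q p v h z)‖ ≤ L * (M * Real.exp (-‖h‖ ^ 2)) := by
  obtain ⟨M, hM, hb⟩ := exists_one_add_pow_mul_exp_le (c := c * (A + B))
    (K := 64 * (A * (1 + ‖q‖) ^ 4 + B * (1 + ‖p‖) ^ 4) + 2 * V) (by positivity) (by positivity)
  refine ⟨M, hM, fun w z v h a L hw hz hwz hv hL ha => ?_⟩
  rw [norm_mul, Complex.norm_exp]
  calc _ ≤ (L * (1 + ‖h‖) ^ 3) * Real.exp ((64 * (A * (1 + ‖q‖) ^ 4 + B * (1 + ‖p‖) ^ 4) + 2 * V) *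
        (1 + ‖h‖) ^ 3 - c * (A + B) * ‖h‖ ^ 4) := by
        gcongr
        refine (re_cphase_le q p v h hw hz hwz hA hB).trans ?_
        gcongr
    _ ≤ L * (M * Real.exp (-‖h‖ ^ 2)) := by
        rw [mul_assoc]
        exact mul_le_mul_of_nonneg_left (hb _ (norm_nonneg h)) hL

theorem re_mul_pow_four (δ σ : ℝ) :
    (Complex.I * (1 + Complex.I * δ) * (1 + σ * Complex.I) ^ 4).re =
      -(4 * σ - 4 * σ ^ 3) - δ * (1 - 6 * σ ^ 2 + σ ^ 4) := by
  have : Complex.I * (1 + Complex.I * δ) * (1 + σ * Complex.I) ^ 4 =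
      ((-(4 * σ - 4 * σ ^ 3) - δ * (1 - 6 * σ ^ 2 + σ ^ 4) : ℝ) : ℂ) +
      ((1 - 6 * σ ^ 2 + σ ^ 4 - δ * (4 * σ - 4 * σ ^ 3) : ℝ) : ℂ) * Complex.I := by
    have h2 : Complex.I ^ 2 = -1 := Complex.I_sq
    have h3 : Complex.I ^ 3 = -Complex.I := by rw [pow_succ, h2]; ring
    have h4 : Complex.I ^ 4 = 1 := by rw [pow_succ, h3, neg_mul, Complex.I_mul_I, neg_neg]
    have h5 : Complex.I ^ 5 = Complex.I := by rw [pow_succ, h4, one_mul]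
    have h6 : Complex.I ^ 6 = -1 := by rw [pow_succ, h5, Complex.I_mul_I]
    push_cast
    ring_nf
    simp only [h2, h3, h4, h5, h6]
    ring
  rw [this, Complex.add_re, Complex.ofReal_re, Complex.re_ofReal_mul, Complex.I_re]
  ring

theorem norm_I_mul_le {δ : ℝ} (h0 : 0 ≤ δ) (h1 : δ ≤ 1) :
    ‖Complex.I * (1 + Complex.I * δ)‖ ≤ 2 := by
  rw [norm_mul, Complex.norm_I, one_mul]
  calc _ ≤ ‖(1 : ℂ)‖ + ‖Complex.I * δ‖ := norm_add_le _ _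
    _ = 1 + δ := by
      rw [norm_mul, Complex.norm_I, one_mul, Complex.norm_real, Real.norm_of_nonneg h0, norm_one]
    _ ≤ 2 := by linarith

theorem norm_one_add_mul_I_lt {σ : ℝ} (h0 : 0 ≤ σ) (h1 : σ ≤ 1 / 10) :
    ‖(1 + σ * Complex.I : ℂ)‖ < 2 := by
  calc _ ≤ ‖(1 : ℂ)‖ + ‖(σ : ℂ) * Complex.I‖ := norm_add_le _ _
    _ = 1 + σ := by
      rw [norm_mul, Complex.norm_I, mul_one, Complex.norm_real, Real.norm_of_nonneg h0, norm_one]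
    _ < 2 := by linarith

/-- Rotation of the contour, about an arbitrary centre `q`, of an integral with the regularised
phase and a weight `W` of cubic growth. -/
theorem integral_weight_mul_cexp_cphase {n : ℕ} {A B δ : ℝ} (hA : 0 ≤ A) (hB : 0 ≤ B)
    (hAB : 0 < A + B) (hδ : 0 < δ) (hδ1 : δ ≤ 1) (q p v : E n) (W : ℂ → E n → ℂ)
    (hWd : ∀ h, Differentiable ℂ fun z => W z h) (hWc : Continuous fun x : ℂ × E n => W x.1 x.2)
    (hWs : ∀ (t : ℝ) z h, W (t * z) h = W z (t • h)) {L : ℝ} (hL : 0 ≤ L)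
    (hWb : ∀ z h, ‖z‖ ≤ 2 → ‖W z h‖ ≤ L * (1 + ‖h‖) ^ 3) :
    ∫ h, W 1 h * Complex.exp (cphase (Complex.I * (1 + Complex.I * δ)) A B q p v h 1) =
      (1 + (1 / 10 : ℝ) * Complex.I) ^ n * ∫ h, W (1 + (1 / 10 : ℝ) * Complex.I) h *
        Complex.exp (cphase (Complex.I * (1 + Complex.I * δ)) A B q p v h
          (1 + (1 / 10 : ℝ) * Complex.I)) := by
  set w : ℂ := Complex.I * (1 + Complex.I * δ) with hw
  refine integral_eq_pow_mul_integral
    (f := fun z h => W z h * Complex.exp (cphase w A B q p v h z)) (by norm_num)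
    (fun h => (hWd h).mul (differentiable_cphase w A B q p v h).cexp) ?_ ?_
    (fun t z h => by rw [hWs, cphase_mul])
  · exact hWc.mul (Complex.continuous_exp.comp (by fun_prop))
  · intro σ hσ
    -- At `σ = 0` the real part is `-δ`: only here is the damping indispensable. For `σ > 0` the
    -- rotation itself contributes `-(4σ - 4σ³)`.
    have hneg : (w * (1 + σ * Complex.I) ^ 4).re < 0 := by
      rw [hw, re_mul_pow_four]
      obtain ⟨h0, h1⟩ := hσ
      have h2 : σ ^ 2 ≤ 1 / 100 := by nlinarith
      have h3 : 0 ≤ 4 * σ - 4 * σ ^ 3 := by nlinarith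
      have h4 : 0 < 1 - 6 * σ ^ 2 + σ ^ 4 := by nlinarith [sq_nonneg (σ ^ 2)]
      nlinarith [mul_pos hδ h4]
    set c := -(w * (1 + σ * Complex.I) ^ 4).re / 2 with hc
    have hc0 : 0 < c := by rw [hc]; linarith
    obtain ⟨M, hM, hb⟩ := exists_norm_mul_cexp_cphase_le hA hB hAB hc0 q p ‖v‖ (norm_nonneg v)
    have hnhds : ∀ᶠ z in 𝓝 (1 + σ * Complex.I : ℂ), ‖z‖ < 2 ∧ (w * z ^ 4).re < -c :=
      ((continuous_norm.tendsto _).eventually_lt_const (norm_one_add_mul_I_lt hσ.1 hσ.2)).and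
        (((by fun_prop : Continuous fun z : ℂ => (w * z ^ 4).re).tendsto _).eventually_lt_const
          (by rw [hc]; linarith))
    obtain ⟨r, hr, hball⟩ := Metric.eventually_nhds_iff_ball.1 hnhds
    refine ⟨r, hr, fun h => L * (M * Real.exp (-‖h‖ ^ 2)),
      (integrable_exp_neg_norm_sq.const_mul M).const_mul L, fun z hz h => ?_⟩
    obtain ⟨h1, h2⟩ := hball z hz
    exact hb w z v h (W z h) L (norm_I_mul_le hδ.le hδ1) h1.le h2.le le_rfl hL (hWb z h h1.le)

/-! ### Uniform bounds through the critical point of the phase -/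

theorem norm_add_smul_sq {n : ℕ} (q h : E n) (t : ℝ) :
    ‖q + t • h‖ ^ 2 = ‖q‖ ^ 2 + 2 * t * inner ℝ q h + t ^ 2 * ‖h‖ ^ 2 := by
  rw [norm_add_sq_real, inner_smul_right, norm_smul, mul_pow, Real.norm_eq_abs, sq_abs]
  ring

theorem hasDerivAt_norm_pow_four {n : ℕ} (q h : E n) :
    HasDerivAt (fun t : ℝ => ‖q + t • h‖ ^ 4) (4 * ‖q‖ ^ 2 * inner ℝ q h) 0 := by
  have e : (fun t : ℝ => ‖q + t • h‖ ^ 4) =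
      fun t => (‖q‖ ^ 2 + 2 * t * inner ℝ q h + t ^ 2 * ‖h‖ ^ 2) ^ 2 := by
    funext t
    rw [← norm_add_smul_sq]
    ring
  rw [e]
  have h1 : HasDerivAt (fun t : ℝ => ‖q‖ ^ 2 + 2 * t * inner ℝ q h + t ^ 2 * ‖h‖ ^ 2)
      (2 * inner ℝ q h) 0 := by
    have := ((((hasDerivAt_id (0 : ℝ)).const_mul 2).mul_const (inner ℝ q h)).const_add
      (‖q‖ ^ 2)).add (((hasDerivAt_id (0 : ℝ)).pow 2).mul_const (‖h‖ ^ 2))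
    simpa [Pi.add_def] using! this
  have h2 := h1.pow 2
  simp only [mul_zero, zero_mul, add_zero, ne_eq, OfNat.ofNat_ne_zero, not_false_eq_true,
    zero_pow] at h2
  refine (h2.congr_deriv ?_ :)
  push_cast
  ring

/-- The convex phase has a critical point. -/
theorem exists_critical_point {n : ℕ} {A B : ℝ} (hA : 0 < A) (hB : 0 ≤ B) (ζ v : E n) :
    ∃ q : E n, ∀ h : E n, 4 * A * ‖q‖ ^ 2 * inner ℝ q h +
      4 * B * ‖q - ζ‖ ^ 2 * inner ℝ (q - ζ) h + inner ℝ h v = 0 := by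
  set f : E n → ℝ := fun q => A * ‖q‖ ^ 4 + B * ‖q - ζ‖ ^ 4 + inner ℝ q v with hf
  have hcont : Continuous f := by fun_prop
  -- The quartic term beats the linear one, so a minimiser exists; the required identity is the
  -- vanishing of its directional derivatives.
  have hlim : Tendsto f (cocompact (E n)) atTop := by
    have h1 : Tendsto (fun t : ℝ => t * (A * t ^ 3 - ‖v‖)) atTop atTop := by
      refine tendsto_id.atTop_mul_atTop₀ (tendsto_atTop_add_const_right _ _ ?_)
      exact (tendsto_pow_atTop (by norm_num)).const_mul_atTop hA
    refine tendsto_atTop_mono (fun q => ?_) (h1.comp (tendsto_norm_cocompact_atTop (E := E n)))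
    have h2 := neg_le_of_abs_le (abs_real_inner_le_norm q v)
    have h3 : 0 ≤ B * ‖q - ζ‖ ^ 4 := by positivity
    simp only [Function.comp, hf]
    nlinarith
  obtain ⟨q, hq⟩ := hcont.exists_forall_le hlim
  refine ⟨q, fun h => ?_⟩
  have hd : HasDerivAt (fun t : ℝ => f (q + t • h)) (A * (4 * ‖q‖ ^ 2 * inner ℝ q h) +
      B * (4 * ‖q - ζ‖ ^ 2 * inner ℝ (q - ζ) h) + inner ℝ h v) 0 := by
    have h1 := (hasDerivAt_norm_pow_four q h).const_mul A
    have h2 := (hasDerivAt_norm_pow_four (q - ζ) h).const_mul B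
    have h3 : HasDerivAt (fun t : ℝ => inner ℝ q v + t * inner ℝ h v) (inner ℝ h v) 0 := by
      simpa using ((hasDerivAt_id (0 : ℝ)).mul_const (inner ℝ h v)).const_add (inner ℝ q v)
    refine ((h1.add h2).add h3).congr_of_eventuallyEq (.of_forall fun t => ?_)
    simp only [hf, Pi.add_apply, inner_add_left, real_inner_smul_left,
      show q + t • h - ζ = q - ζ + t • h by abel]
  have hmin : IsLocalMin (fun t : ℝ => f (q + t • h)) 0 :=
    .of_forall fun t => by simpa using hq (q + t • h)
  linarith [hmin.hasDerivAt_eq_zero hd]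

/-- The term linear in `h` is kept exactly, since it will be cancelled by the critical point
equation. The rest is controlled by Cauchy–Schwarz, `⟪q, h⟫² ≤ ‖q‖²‖h‖²`. -/
theorem re_mul_csq_sq_le {n : ℕ} (q h : E n) {δ : ℝ} (h0 : 0 ≤ δ) (h1 : δ ≤ 1) :
    (Complex.I * (1 + Complex.I * δ) * csq q h (1 + (1 / 10 : ℝ) * Complex.I) ^ 2).re ≤
      -(2 / 5) * ‖q‖ ^ 2 * inner ℝ q h - 1 / 20 * (‖q‖ ^ 2 * ‖h‖ ^ 2 + ‖h‖ ^ 4) := by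
  set T := ‖q‖ ^ 2 with hT
  set r := ‖h‖ ^ 2 with hr
  set s : ℝ := inner ℝ q h with hs
  have hTn : 0 ≤ T := sq_nonneg _
  have hrn : 0 ≤ r := sq_nonneg _
  have hsT : s ^ 2 ≤ T * r := by
    rw [hT, hr, ← mul_pow, ← sq_abs s]
    exact pow_le_pow_left₀ (abs_nonneg _) (abs_real_inner_le_norm q h) 2
  have e : csq q h (1 + (1 / 10 : ℝ) * Complex.I) =
      ((T + 2 * s + 99 / 100 * r : ℝ) : ℂ) + ((1 / 5 * (s + r) : ℝ) : ℂ) * Complex.I := by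
    rw [csq, ← hs, ← Complex.ofReal_pow ‖q‖, ← Complex.ofReal_pow ‖h‖, ← hT, ← hr]
    push_cast
    ring_nf
    rw [Complex.I_sq]
    ring
  set X := T + 2 * s + 99 / 100 * r with hX
  set Y := 1 / 5 * (s + r) with hY
  have e2 : (Complex.I * (1 + Complex.I * δ) * ((X : ℂ) + (Y : ℂ) * Complex.I) ^ 2) =
      ((-(2 * X * Y) - δ * (X ^ 2 - Y ^ 2) : ℝ) : ℂ) +
      ((X ^ 2 - Y ^ 2 - 2 * δ * X * Y : ℝ) : ℂ) * Complex.I := by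
    have h2 : Complex.I ^ 2 = -1 := Complex.I_sq
    have h3 : Complex.I ^ 3 = -Complex.I := by rw [pow_succ, h2]; ring
    have h4 : Complex.I ^ 4 = 1 := by rw [pow_succ, h3, neg_mul, Complex.I_mul_I, neg_neg]
    push_cast
    ring_nf
    simp only [h2, h3, h4]
    ring
  have h4 : ‖h‖ ^ 4 = r ^ 2 := by rw [hr]; ring
  rw [e, e2, Complex.add_re, Complex.ofReal_re, Complex.re_ofReal_mul, Complex.I_re, h4]
  -- The damping contributes with an almost favourable sign: with `u = ‖q + h‖²` one has `X = u -
  -- r/100` and `Y² ≤ ur/25`, and completing the square in `u` leaves only a small multiple of `r²`.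
  have hre : -(8 / 10000) * r ^ 2 ≤ X ^ 2 - Y ^ 2 := by
    have hY2 : Y ^ 2 ≤ 1 / 25 * ((T + 2 * s + r) * r) := by
      rw [hY]
      nlinarith
    have hX2 : X ^ 2 = (T + 2 * s + r - 3 / 100 * r) ^ 2 - 8 / 10000 * r ^ 2 +
        1 / 25 * ((T + 2 * s + r) * r) := by
      rw [hX]
      ring
    nlinarith [sq_nonneg (T + 2 * s + r - 3 / 100 * r)]
  have hre2 : -(8 / 10000) * r ^ 2 ≤ δ * (X ^ 2 - Y ^ 2) := by
    nlinarith [mul_le_mul_of_nonneg_left hre h0, sq_nonneg r]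
  -- After spending `(3/10)Tr ≥ (3/10)s²`, the form `1.1s² + 1.196sr + 0.326r²` must be nonnegative;
  -- its discriminant is negative, and the hint is its completed square.
  have hmain : 2 / 5 * T * s + 1 / 10 * (T * r) + 7 / 100 * r ^ 2 ≤ 2 * X * Y := by
    rw [hX, hY]
    nlinarith [sq_nonneg (s + 1196 / 2200 * r)]
  nlinarith [mul_nonneg hTn hrn, sq_nonneg r]

/-- At a critical point of the phase the rotated exponential decays. -/
theorem norm_cexp_cphase_le {n : ℕ} {A B δ : ℝ} (hA : 0 ≤ A) (hB : 0 ≤ B) (h0 : 0 ≤ δ)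
    (h1 : δ ≤ 1) {q p v : E n}
    (hq : ∀ h : E n, 4 * A * ‖q‖ ^ 2 * inner ℝ q h + 4 * B * ‖p‖ ^ 2 * inner ℝ p h +
      inner ℝ h v = 0) (h : E n) :
    ‖Complex.exp (cphase (Complex.I * (1 + Complex.I * δ)) A B q p v h
      (1 + (1 / 10 : ℝ) * Complex.I))‖ ≤
      Real.exp (-(1 / 20) * ((A + B) * ‖h‖ ^ 4 + B * ‖p‖ ^ 2 * ‖h‖ ^ 2)) := by
  rw [Complex.norm_exp]
  apply Real.exp_le_exp.2
  set z : ℂ := 1 + (1 / 10 : ℝ) * Complex.I with hz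
  set w : ℂ := Complex.I * (1 + Complex.I * δ) with hw
  have e : cphase w A B q p v h z = w * csq q h z ^ 2 * (A : ℝ) + w * csq p h z ^ 2 * (B : ℝ) +
      (((-(1 / 10) * inner ℝ h v : ℝ) : ℂ) +
        ((inner ℝ q v + inner ℝ h v : ℝ) : ℂ) * Complex.I) := by
    rw [cphase, hz]
    push_cast
    ring_nf
    rw [Complex.I_sq]
    ring
  rw [e, Complex.add_re, Complex.add_re, Complex.add_re, Complex.re_mul_ofReal,
    Complex.re_mul_ofReal, Complex.ofReal_re, Complex.re_ofReal_mul, Complex.I_re]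
  have hqA := mul_le_mul_of_nonneg_right (re_mul_csq_sq_le q h h0 h1) hA
  have hpB := mul_le_mul_of_nonneg_right (re_mul_csq_sq_le p h h0 h1) hB
  have h3 : 0 ≤ A * (‖q‖ ^ 2 * ‖h‖ ^ 2) := by positivity
  have h4 := hq h
  nlinarith

/-! ### The regularised oscillatory integral -/

/-- The integral of `exp (i (1 + i δ) (A ‖ξ‖⁴ + B ‖ξ - ζ‖⁴) + i ⟪ξ, v⟫)`. -/
noncomputable def osc {n : ℕ} (A B δ : ℝ) (ζ v : E n) : ℂ :=
  ∫ ξ : E n, Complex.exp (Complex.I * (1 + Complex.I * δ) *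
    ((A * ‖ξ‖ ^ 4 + B * ‖ξ - ζ‖ ^ 4 : ℝ) : ℂ) + Complex.I * (inner ℝ ξ v : ℝ))

theorem cphase_one {n : ℕ} (w : ℂ) (A B : ℝ) (q p v h : E n) :
    cphase w A B q p v h 1 = w * ((A * ‖q + h‖ ^ 4 + B * ‖p + h‖ ^ 4 : ℝ) : ℂ) +
      Complex.I * (inner ℝ (q + h) v : ℝ) := by
  rw [cphase, csq_one, csq_one, inner_add_left]
  push_cast
  ring

/-- The regularised oscillatory integral on the contour rotated about `q`. -/
theorem osc_eq {n : ℕ} {A B δ : ℝ} (hA : 0 ≤ A) (hB : 0 ≤ B) (hAB : 0 < A + B)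
    (hδ : 0 < δ) (hδ1 : δ ≤ 1) (ζ v q : E n) :
    osc A B δ ζ v = (1 + (1 / 10 : ℝ) * Complex.I) ^ n * ∫ h,
        Complex.exp (cphase (Complex.I * (1 + Complex.I * δ)) A B q (q - ζ) v h
          (1 + (1 / 10 : ℝ) * Complex.I)) := by
  have := integral_weight_mul_cexp_cphase hA hB hAB hδ hδ1 q (q - ζ) v (fun _ _ => 1)
    (fun _ => differentiable_const _) continuous_const (fun _ _ _ => rfl) zero_le_one
    (fun z h _ => by
      rw [norm_one, one_mul]
      exact one_le_pow₀ (by linarith [norm_nonneg h]))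
  simp only [one_mul] at this
  rw [← this, osc, ← integral_add_left_eq_self _ q]
  refine integral_congr_ae (.of_forall fun h => ?_)
  simp only [cphase_one, sub_add_eq_add_sub]

theorem norm_rotation_pow_le (n : ℕ) : ‖(1 + (1 / 10 : ℝ) * Complex.I : ℂ) ^ n‖ ≤ 2 ^ n := by
  rw [norm_pow]
  exact pow_le_pow_left₀ (norm_nonneg _)
    (norm_one_add_mul_I_lt (by norm_num) (by norm_num)).le n

theorem integrable_exp_neg_norm_pow_four {n : ℕ} {c : ℝ} (hc : 0 < c) :
    Integrable fun h : E n => Real.exp (-c * ‖h‖ ^ 4) := by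
  refine ((integrable_exp_neg_norm_sq (n := n)).const_mul (Real.exp (1 / (4 * c)))).mono'
    (by fun_prop : Continuous _).aestronglyMeasurable (.of_forall fun h => ?_)
  rw [Real.norm_of_nonneg (Real.exp_nonneg _), ← Real.exp_add]
  apply Real.exp_le_exp.2
  have : 1 / (4 * c) + -‖h‖ ^ 2 + c * ‖h‖ ^ 4 = c * (‖h‖ ^ 2 - 1 / (2 * c)) ^ 2 := by
    field_simp
    ring
  nlinarith [mul_nonneg hc.le (sq_nonneg (‖h‖ ^ 2 - 1 / (2 * c)))]

theorem integral_exp_neg_norm_pow_four {n : ℕ} {T : ℝ} (hT : 0 < T) :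
    ∫ h : E n, Real.exp (-(1 / 20) * (T * ‖h‖ ^ 4)) =
      T ^ (-(n / 4 : ℝ)) * ∫ h : E n, Real.exp (-(1 / 20) * ‖h‖ ^ 4) := by
  have h0 : 0 ≤ T ^ (1 / 4 : ℝ) := by positivity
  have hT4 : (T ^ (1 / 4 : ℝ)) ^ 4 = T := by
    rw [← Real.rpow_natCast, ← Real.rpow_mul hT.le]
    norm_num
  have := Measure.integral_comp_smul_of_nonneg (volume : Measure (E n))
    (fun h => Real.exp (-(1 / 20) * ‖h‖ ^ 4)) (T ^ (1 / 4 : ℝ)) (hR := h0)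
  simp only [norm_smul, Real.norm_of_nonneg h0, mul_pow, hT4] at this
  rw [this, finrank_euclideanSpace_fin, smul_eq_mul, ← Real.rpow_natCast, ← Real.rpow_mul hT.le,
    ← Real.rpow_neg hT.le]
  congr 2
  ring

/-- The dispersive bound, uniform in `δ`, `ζ` and `v`. -/
theorem exists_norm_osc_le (n : ℕ) : ∃ C > 0, ∀ {A B δ : ℝ}, 0 < A → 0 ≤ B → 0 < δ → δ ≤ 1 →
    ∀ ζ v : E n, ‖osc A B δ ζ v‖ ≤ C * (A + B) ^ (-(n / 4 : ℝ)) := by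
  refine ⟨2 ^ n * ((∫ h : E n, Real.exp (-(1 / 20) * ‖h‖ ^ 4)) + 1), ?_, ?_⟩
  · have : 0 ≤ ∫ h : E n, Real.exp (-(1 / 20) * ‖h‖ ^ 4) :=
      integral_nonneg fun _ => Real.exp_nonneg _
    positivity
  intro A B δ hA hB hδ hδ1 ζ v
  have hT : 0 < A + B := by positivity
  -- The centre depends on `ζ` and `v`, but the decay about it does not; this is the source of
  -- uniformity.
  obtain ⟨q, hq⟩ := exists_critical_point hA hB ζ v
  rw [osc_eq hA.le hB hT hδ hδ1 ζ v q, norm_mul, mul_assoc]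
  refine mul_le_mul (norm_rotation_pow_le n) ?_ (norm_nonneg _) (by positivity)
  have hint : Integrable fun h : E n => Real.exp (-(1 / 20) * ((A + B) * ‖h‖ ^ 4)) := by
    simpa only [neg_mul, mul_assoc] using
      integrable_exp_neg_norm_pow_four (n := n) (c := 1 / 20 * (A + B)) (by positivity)
  calc _ ≤ ∫ h : E n, Real.exp (-(1 / 20) * ((A + B) * ‖h‖ ^ 4)) := by
        refine norm_integral_le_of_norm_le hint (.of_forall fun h => ?_)
        refine (norm_cexp_cphase_le hA.le hB hδ.le hδ1 hq h).trans (Real.exp_le_exp.2 ?_)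
        have : 0 ≤ B * ‖q - ζ‖ ^ 2 * ‖h‖ ^ 2 := by positivity
        linarith
    _ ≤ _ := by
        rw [integral_exp_neg_norm_pow_four hT, mul_comm]
        gcongr
        linarith

/-! ### Lipschitz dependence on the frequency shift -/

theorem integrable_one_add_pow_mul_exp {n : ℕ} {c : ℝ} (hc : 0 < c) :
    Integrable fun h : E n => (1 + ‖h‖) ^ 3 * Real.exp (-c * ‖h‖ ^ 4) := by
  obtain ⟨M, hM, hb⟩ := exists_one_add_pow_mul_exp_le hc le_rfl
  refine ((integrable_exp_neg_norm_sq (n := n)).const_mul M).mono'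
    (by fun_prop : Continuous _).aestronglyMeasurable (.of_forall fun h => ?_)
  rw [Real.norm_of_nonneg (by positivity)]
  simpa using hb ‖h‖ (norm_nonneg h)

theorem integrable_one_add_two_mul_pow_mul_exp {n : ℕ} :
    Integrable fun h : E n => (1 + 2 * ‖h‖) ^ 3 * Real.exp (-(1 / 20) * ‖h‖ ^ 2) := by
  -- Half of the Gaussian absorbs the polynomial: `6t - t²/40 ≤ 360`.
  refine ((integrable_exp_neg_mul_norm_sq (n := n) (c := 1 / 40)
    (by norm_num)).const_mul (Real.exp 360)).mono'
    (by fun_prop : Continuous _).aestronglyMeasurable (.of_forall fun h => ?_)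
  rw [Real.norm_of_nonneg (by positivity), ← Real.exp_add]
  have h1 : (1 + 2 * ‖h‖) ^ 3 ≤ Real.exp (6 * ‖h‖) := by
    calc _ ≤ Real.exp (2 * ‖h‖) ^ 3 := by
          gcongr
          linarith [Real.add_one_le_exp (2 * ‖h‖)]
      _ = _ := by
          rw [← Real.exp_nat_mul]
          congr 1
          push_cast
          ring
  calc _ ≤ Real.exp (6 * ‖h‖) * Real.exp (-(1 / 20) * ‖h‖ ^ 2) := by gcongr
    _ = Real.exp (6 * ‖h‖ + -(1 / 20) * ‖h‖ ^ 2) := (Real.exp_add _ _).symm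
    _ ≤ _ := Real.exp_le_exp.2 (by nlinarith [sq_nonneg (‖h‖ - 120)])

/-- Here `P` is the distance from the critical point to the shift, which is unbounded. For `P ≤ 1`
the quartic decay suffices. For `P ≥ 1` the quadratic decay has width `1/P`, so rescaling gains
`P^{-n}` against the weight's `P³`; this is why `3 ≤ n` is needed. -/
theorem exists_norm_integral_cubic_le {n : ℕ} (hn : 3 ≤ n) : ∃ C > 0, ∀ (T B P : ℝ) (f : E n → ℂ),
    1 ≤ T → 1 ≤ B → 0 ≤ P → (∀ h, ‖f h‖ ≤ (P + 2 * ‖h‖) ^ 3 *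
      Real.exp (-(1 / 20) * (T * ‖h‖ ^ 4 + B * P ^ 2 * ‖h‖ ^ 2))) → ‖∫ h, f h‖ ≤ C := by
  set φ : E n → ℝ := fun h => (1 + 2 * ‖h‖) ^ 3 * Real.exp (-(1 / 20) * ‖h‖ ^ 2) with hφ
  set ψ : E n → ℝ := fun h => 8 * ((1 + ‖h‖) ^ 3 * Real.exp (-(1 / 20) * ‖h‖ ^ 4)) with hψ
  have hφi : Integrable φ := integrable_one_add_two_mul_pow_mul_exp
  have hψi : Integrable ψ := (integrable_one_add_pow_mul_exp (by norm_num)).const_mul 8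
  have hφ0 : 0 ≤ ∫ h, φ h := integral_nonneg fun h => by positivity
  have hψ0 : 0 ≤ ∫ h, ψ h := integral_nonneg fun h => by positivity
  refine ⟨(∫ h, φ h) + (∫ h, ψ h) + 1, by positivity, fun T B P f hT hB hP hf => ?_⟩
  rcases le_total P 1 with hP1 | hP1
  · have : ‖∫ h, f h‖ ≤ ∫ h, ψ h := by
      refine norm_integral_le_of_norm_le hψi (.of_forall fun h => (hf h).trans ?_)
      simp only [hψ]
      rw [← mul_assoc]
      gcongr ?_ * Real.exp ?_
      · calc (P + 2 * ‖h‖) ^ 3 ≤ (2 * (1 + ‖h‖)) ^ 3 := by gcongr; linarith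
          _ = _ := by ring
      · have h1 : 0 ≤ B * P ^ 2 * ‖h‖ ^ 2 := by positivity
        nlinarith [mul_le_mul_of_nonneg_right hT (by positivity : 0 ≤ ‖h‖ ^ 4)]
    linarith
  · have h1 : ‖∫ h, f h‖ ≤ ∫ h, P ^ 3 * φ (P • h) := by
      refine norm_integral_le_of_norm_le ((hφi.comp_smul (by positivity)).const_mul _)
        (.of_forall fun h => (hf h).trans ?_)
      simp only [hφ, norm_smul, Real.norm_of_nonneg hP]
      rw [← mul_assoc, ← mul_pow]
      gcongr ?_ * Real.exp ?_
      · gcongr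
        nlinarith [norm_nonneg h, mul_le_mul hP1 hP1 zero_le_one hP]
      · have h2 : 0 ≤ T * ‖h‖ ^ 4 := by positivity
        nlinarith [mul_le_mul_of_nonneg_right hB (by positivity : 0 ≤ P ^ 2 * ‖h‖ ^ 2)]
    have h2 : ∫ h, P ^ 3 * φ (P • h) = P ^ 3 * (P ^ n)⁻¹ * ∫ h, φ h := by
      rw [integral_const_mul, Measure.integral_comp_smul_of_nonneg volume φ P (hR := hP)]
      simp [mul_assoc]
    have h3 : P ^ 3 * (P ^ n)⁻¹ ≤ 1 := by
      rw [← div_eq_mul_inv, div_le_one (by positivity)]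
      exact pow_le_pow_right₀ hP1 hn
    nlinarith

theorem norm_cexp_osc_le {n : ℕ} {A B δ : ℝ} (hB : 0 ≤ B) (hδ : 0 ≤ δ) (ξ ζ v : E n) :
    ‖Complex.exp (Complex.I * (1 + Complex.I * δ) *
      ((A * ‖ξ‖ ^ 4 + B * ‖ξ - ζ‖ ^ 4 : ℝ) : ℂ) + Complex.I * (inner ℝ ξ v : ℝ))‖ ≤
      Real.exp (-(δ * A) * ‖ξ‖ ^ 4) := by
  rw [Complex.norm_exp]
  apply Real.exp_le_exp.2
  rw [Complex.add_re, Complex.re_mul_ofReal]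
  have h1 : (Complex.I * (1 + Complex.I * δ)).re = -δ := by simp
  have h2 : (Complex.I * ((inner ℝ ξ v : ℝ) : ℂ)).re = 0 := by simp
  rw [h1, h2]
  have h3 : 0 ≤ δ * (B * ‖ξ - ζ‖ ^ 4) := by positivity
  linarith

/-- Differentiation takes place on the real contour, where the damping `exp (-δA‖ξ‖⁴)` dominates the
cubic weight. The domination depends on `δ`; uniformity is recovered only after rotation. -/
theorem hasDerivAt_osc {n : ℕ} {A B δ : ℝ} (hA : 0 < A) (hB : 0 ≤ B) (hδ : 0 < δ) (hδ1 : δ ≤ 1)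
    (ζ v : E n) (s₀ : ℝ) :
    HasDerivAt (fun s : ℝ => osc A B δ (s • ζ) v)
      (∫ ξ : E n, -(4 * (Complex.I * (1 + Complex.I * δ)) * B) *
        (((‖ξ - s₀ • ζ‖ ^ 2 * inner ℝ (ξ - s₀ • ζ) ζ : ℝ) : ℂ) *
        Complex.exp (Complex.I * (1 + Complex.I * δ) *
          ((A * ‖ξ‖ ^ 4 + B * ‖ξ - s₀ • ζ‖ ^ 4 : ℝ) : ℂ) + Complex.I * (inner ℝ ξ v : ℝ)))) s₀ := by
  set w : ℂ := Complex.I * (1 + Complex.I * δ) with hw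
  set K : ℝ := 1 + (|s₀| + 1) * ‖ζ‖ with hK
  have hK1 : 1 ≤ K := by
    have : 0 ≤ (|s₀| + 1) * ‖ζ‖ := by positivity
    linarith
  refine (hasDerivAt_integral_of_dominated_loc_of_deriv_le
    (F := fun (s : ℝ) (ξ : E n) => Complex.exp (w * ((A * ‖ξ‖ ^ 4 + B * ‖ξ - s • ζ‖ ^ 4 : ℝ) : ℂ) +
      Complex.I * (inner ℝ ξ v : ℝ)))
    (F' := fun s ξ => -(4 * w * B) * (((‖ξ - s • ζ‖ ^ 2 * inner ℝ (ξ - s • ζ) ζ : ℝ) : ℂ) *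
      Complex.exp (w * ((A * ‖ξ‖ ^ 4 + B * ‖ξ - s • ζ‖ ^ 4 : ℝ) : ℂ) +
        Complex.I * (inner ℝ ξ v : ℝ))))
    (bound := fun ξ => 8 * B * K ^ 3 * ‖ζ‖ * ((1 + ‖ξ‖) ^ 3 * Real.exp (-(δ * A) * ‖ξ‖ ^ 4)))
    (Metric.ball_mem_nhds s₀ one_pos)
    (.of_forall fun s => (by fun_prop : Continuous _).aestronglyMeasurable) ?_
    (by fun_prop : Continuous _).aestronglyMeasurable ?_ ?_ ?_).2
  · exact (integrable_exp_neg_norm_pow_four (mul_pos hδ hA)).mono'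
      (by fun_prop : Continuous _).aestronglyMeasurable
      (.of_forall fun ξ => norm_cexp_osc_le hB hδ.le ξ _ v)
  · refine .of_forall fun ξ s hs => ?_
    have hs' : |s| ≤ |s₀| + 1 := by
      rw [Metric.mem_ball, Real.dist_eq] at hs
      linarith [abs_sub_abs_le_abs_sub s s₀]
    have hnorm : ‖ξ - s • ζ‖ ≤ K * (1 + ‖ξ‖) := by
      calc _ ≤ ‖ξ‖ + |s| * ‖ζ‖ := by simpa [norm_smul] using norm_sub_le ξ (s • ζ)
        _ ≤ ‖ξ‖ + (|s₀| + 1) * ‖ζ‖ := by gcongr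
        _ = ‖ξ‖ + (K - 1) := by rw [hK]; ring
        _ ≤ _ := by nlinarith [norm_nonneg ξ]
    have hin : ‖inner ℝ (ξ - s • ζ) ζ‖ ≤ K * (1 + ‖ξ‖) * ‖ζ‖ :=
      (norm_inner_le_norm _ _).trans (by gcongr)
    rw [norm_mul, norm_mul, norm_neg, norm_mul, norm_mul _ w, Complex.norm_real, Complex.norm_real,
      Real.norm_of_nonneg hB, norm_mul (‖ξ - s • ζ‖ ^ 2), norm_pow, norm_norm, Complex.norm_ofNat]
    calc _ ≤ 4 * 2 * B * ((K * (1 + ‖ξ‖)) ^ 2 * (K * (1 + ‖ξ‖) * ‖ζ‖) *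
          Real.exp (-(δ * A) * ‖ξ‖ ^ 4)) := by
          gcongr
          · exact norm_I_mul_le hδ.le hδ1
          · exact norm_cexp_osc_le hB hδ.le ξ _ v
      _ = _ := by ring
  · exact (integrable_one_add_pow_mul_exp (mul_pos hδ hA)).const_mul _
  · refine .of_forall fun ξ s _ => ?_
    have h1 : HasDerivAt (fun s : ℝ => ‖ξ - s • ζ‖ ^ 4)
        (4 * ‖ξ - s • ζ‖ ^ 2 * inner ℝ (ξ - s • ζ) (-ζ)) s := by
      have h2 := hasDerivAt_norm_pow_four (ξ - s • ζ) (-ζ)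
      have h3 : HasDerivAt (fun t : ℝ => t - s) 1 s := (hasDerivAt_id s).sub_const s
      have h4 := HasDerivAt.comp (h := fun t : ℝ => t - s) s
        (by simpa only [sub_self] using h2) h3
      rw [mul_one] at h4
      refine h4.congr_of_eventuallyEq (.of_forall fun t => ?_)
      simp only [Function.comp]
      congr 2
      module
    have h2 := ((((h1.const_mul B).const_add (A * ‖ξ‖ ^ 4)).ofReal_comp.const_mul w).add_const
      (Complex.I * (inner ℝ ξ v : ℝ))).cexp
    refine (h2.congr_deriv ?_ :)
    rw [inner_neg_right]
    push_cast
    ring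

theorem norm_weight_le {n : ℕ} (p h ζ : E n) {z : ℂ} (hz : ‖z‖ ≤ 2) :
    ‖csq p h z * ((inner ℝ p ζ : ℝ) + z * (inner ℝ h ζ : ℝ))‖ ≤
      ‖ζ‖ * (‖p‖ + 2 * ‖h‖) ^ 3 := by
  have h1 : ‖csq p h z‖ ≤ (‖p‖ + 2 * ‖h‖) ^ 2 := (norm_csq_le p h z).trans (by gcongr)
  have h2 : ‖((inner ℝ p ζ : ℝ) : ℂ) + z * (inner ℝ h ζ : ℝ)‖ ≤ (‖p‖ + 2 * ‖h‖) * ‖ζ‖ := by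
    calc _ ≤ ‖((inner ℝ p ζ : ℝ) : ℂ)‖ + ‖z * ((inner ℝ h ζ : ℝ) : ℂ)‖ := norm_add_le _ _
      _ ≤ ‖p‖ * ‖ζ‖ + 2 * (‖h‖ * ‖ζ‖) := by
        rw [norm_mul, Complex.norm_real, Complex.norm_real]
        gcongr
        · exact norm_inner_le_norm p ζ
        · exact norm_inner_le_norm h ζ
      _ = _ := by ring
  rw [norm_mul]
  calc _ ≤ (‖p‖ + 2 * ‖h‖) ^ 2 * ((‖p‖ + 2 * ‖h‖) * ‖ζ‖) := by gcongr
    _ = _ := by ring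

/-- Mean value inequality along `s ↦ s • ζ`. For each `s` the derivative is rotated about the
critical point of the phase with shift `s • ζ`, its cubic weight being continued holomorphically as
well. -/
theorem exists_norm_osc_sub_le {n : ℕ} (hn : 3 ≤ n) : ∃ C > 0, ∀ {A B δ : ℝ}, 0 < A → 1 ≤ B →
    0 < δ → δ ≤ 1 → ∀ ζ v : E n, ‖osc A B δ ζ v - osc A B δ 0 v‖ ≤ C * B * ‖ζ‖ := by
  obtain ⟨C, hC, hbound⟩ := exists_norm_integral_cubic_le hn
  refine ⟨8 * 2 ^ n * C, by positivity, fun {A B δ} hA hB hδ hδ1 ζ v => ?_⟩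
  have hB0 : 0 ≤ B := zero_le_one.trans hB
  have hAB : 0 < A + B := by linarith
  have key := norm_image_sub_le_of_norm_deriv_le_segment_01'
    (f := fun s : ℝ => osc A B δ (s • ζ) v) (C := 8 * 2 ^ n * C * B * ‖ζ‖)
    (fun s _ => (hasDerivAt_osc hA hB0 hδ hδ1 ζ v s).hasDerivWithinAt) fun s _ => ?_
  · simpa using key
  · obtain ⟨q, hq⟩ := exists_critical_point hA hB0 (s • ζ) v
    set p := q - s • ζ with hp
    set w : ℂ := Complex.I * (1 + Complex.I * δ) with hw
    have hrot := integral_weight_mul_cexp_cphase hA.le hB0 hAB hδ hδ1 q p v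
      (fun z h => csq p h z * ((inner ℝ p ζ : ℝ) + z * (inner ℝ h ζ : ℝ)))
      (fun h => (differentiable_csq p h).mul (by fun_prop)) (by fun_prop)
      (fun t z h => by
        rw [csq_mul, real_inner_smul_left]
        push_cast
        ring)
      (L := ‖ζ‖ * (2 + ‖p‖) ^ 3) (by positivity)
      (fun z h hz => by
        refine (norm_weight_le p h ζ hz).trans ?_
        rw [mul_assoc, ← mul_pow]
        gcongr
        nlinarith [mul_nonneg (norm_nonneg p) (norm_nonneg h)])
    rw [← hw] at hrot
    have e : (∫ ξ : E n, ((‖ξ - s • ζ‖ ^ 2 * inner ℝ (ξ - s • ζ) ζ : ℝ) : ℂ) *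
        Complex.exp (w * ((A * ‖ξ‖ ^ 4 + B * ‖ξ - s • ζ‖ ^ 4 : ℝ) : ℂ) +
          Complex.I * (inner ℝ ξ v : ℝ))) =
        ∫ h, csq p h 1 * ((inner ℝ p ζ : ℝ) + 1 * (inner ℝ h ζ : ℝ)) *
          Complex.exp (cphase w A B q p v h 1) := by
      rw [← integral_add_left_eq_self _ q]
      refine integral_congr_ae (.of_forall fun h => ?_)
      simp only [cphase_one, csq_one, one_mul, ← sub_add_eq_add_sub, ← hp, inner_add_left]
      push_cast
      rfl
    set z : ℂ := 1 + (1 / 10 : ℝ) * Complex.I with hz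
    have hz2 : ‖z‖ ≤ 2 := (norm_one_add_mul_I_lt (by norm_num) (by norm_num)).le
    rw [integral_const_mul, e, hrot]
    -- The weight is linear in `ζ`; dividing by `‖ζ‖` brings it to the normalised form. For `ζ = 0`
    -- the inverse is `0` and the bound is trivial.
    have h2 := hbound (A + B) B ‖p‖ (fun h => (‖ζ‖⁻¹ : ℝ) *
      (csq p h z * ((inner ℝ p ζ : ℝ) + z * (inner ℝ h ζ : ℝ)) *
        Complex.exp (cphase w A B q p v h z))) (by linarith) hB (norm_nonneg _) fun h => by
      have h3 := norm_weight_le p h ζ hz2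
      have h4 := norm_cexp_cphase_le hA.le hB0 hδ.le hδ1 hq h
      rw [norm_mul, norm_mul, Complex.norm_real, norm_inv, norm_norm, ← mul_assoc]
      refine mul_le_mul ?_ h4 (norm_nonneg _) (by positivity)
      rcases (norm_nonneg ζ).eq_or_lt with h0 | h0
      · rw [← h0, inv_zero, zero_mul]
        positivity
      · rwa [inv_mul_le_iff₀ h0]
    rw [integral_const_mul, norm_mul, Complex.norm_real, norm_inv, norm_norm] at h2
    have h3 : ‖∫ h, csq p h z * ((inner ℝ p ζ : ℝ) + z * (inner ℝ h ζ : ℝ)) *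
        Complex.exp (cphase w A B q p v h z)‖ ≤ ‖ζ‖ * C := by
      rcases (norm_nonneg ζ).eq_or_lt with h0 | h0
      · have : ζ = 0 := norm_eq_zero.1 h0.symm
        subst this
        simp
      · rwa [inv_mul_le_iff₀ h0] at h2
    rw [norm_mul, norm_neg, norm_mul, norm_mul _ w, norm_mul (z ^ n), Complex.norm_real,
      Real.norm_of_nonneg hB0, Complex.norm_ofNat]
    calc _ ≤ 4 * 2 * B * (2 ^ n * (‖ζ‖ * C)) := by
          gcongr
          · exact norm_I_mul_le hδ.le hδ1
          · exact norm_rotation_pow_le n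
      _ = _ := by ring

/-! ### Existence of the oscillatory integral -/

/-- The absolutely convergent rotated form of the regularised fundamental solution. -/
noncomputable def rotatedSol {n : ℕ} (δ : ℝ) (x : E n) : ℂ :=
  (1 + (1 / 10 : ℝ) * Complex.I) ^ n * ∫ h : E n,
    Complex.exp (cphase (Complex.I * (1 + Complex.I * δ)) 1 0 0 0 x h
      (1 + (1 / 10 : ℝ) * Complex.I))

theorem osc_eq_rotatedSol {n : ℕ} {δ : ℝ} (hδ : 0 < δ) (hδ1 : δ ≤ 1) (x : E n) :
    osc 1 0 δ 0 x = rotatedSol δ x := by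
  rw [osc_eq zero_le_one le_rfl (by norm_num) hδ hδ1 0 x 0, sub_zero]
  rfl

/-- At the full angle `Re (w z⁴) ≤ -0.396` even for `δ = 0`, whence the choice `3 / 10`. This
domination, uniform down to `δ = 0` and locally uniform in `x`, gives both the limit `δ → 0` and
continuity. -/
theorem exists_norm_cexp_cphase_rotated_le (n : ℕ) (V : ℝ) (hV : 0 ≤ V) :
    ∃ M > 0, ∀ (δ : ℝ) (x h : E n), 0 ≤ δ → δ ≤ 1 → ‖x‖ ≤ V →
      ‖Complex.exp (cphase (Complex.I * (1 + Complex.I * δ)) 1 0 0 0 x h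
        (1 + (1 / 10 : ℝ) * Complex.I))‖ ≤ M * Real.exp (-‖h‖ ^ 2) := by
  obtain ⟨M, hM, hb⟩ := exists_norm_mul_cexp_cphase_le (n := n) (A := 1) (B := 0) (c := 3 / 10)
    zero_le_one le_rfl (by norm_num) (by norm_num) 0 0 V hV
  refine ⟨M, hM, fun δ x h h0 h1 hx => ?_⟩
  have := hb (Complex.I * (1 + Complex.I * δ)) (1 + (1 / 10 : ℝ) * Complex.I) x h 1 1
    (norm_I_mul_le h0 h1) (norm_one_add_mul_I_lt (by norm_num) (by norm_num)).le
    (by rw [re_mul_pow_four]; nlinarith) hx zero_le_one (by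
      rw [norm_one, one_mul]
      exact one_le_pow₀ (by linarith [norm_nonneg h]))
  simpa only [one_mul] using this

theorem eventually_mem_Ioc_zero_one : ∀ᶠ δ : ℝ in 𝓝[>] 0, 0 < δ ∧ δ ≤ 1 := by
  filter_upwards [Ioc_mem_nhdsGT (zero_lt_one' ℝ)] with δ hδ using hδ

theorem tendsto_rotatedSol {n : ℕ} (x : E n) :
    Tendsto (fun δ => rotatedSol δ x) (𝓝[>] 0) (𝓝 (rotatedSol 0 x)) := by
  obtain ⟨M, hM, hb⟩ := exists_norm_cexp_cphase_rotated_le n ‖x‖ (norm_nonneg x)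
  refine Tendsto.const_mul _ (tendsto_integral_filter_of_dominated_convergence
    (fun h => M * Real.exp (-‖h‖ ^ 2))
    (.of_forall fun δ => (by fun_prop : Continuous _).aestronglyMeasurable) ?_
    (integrable_exp_neg_norm_sq.const_mul M) (.of_forall fun h => ?_))
  · filter_upwards [eventually_mem_Ioc_zero_one] with δ hδ
    exact .of_forall fun h => hb δ x h hδ.1.le hδ.2 le_rfl
  · exact ((by fun_prop : Continuous fun δ : ℝ =>
      Complex.exp (cphase (Complex.I * (1 + Complex.I * δ)) 1 0 0 0 x h
        (1 + (1 / 10 : ℝ) * Complex.I))).tendsto 0).mono_left nhdsWithin_le_nhds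

theorem tendsto_osc {n : ℕ} (x : E n) :
    Tendsto (fun δ => osc 1 0 δ 0 x) (𝓝[>] 0) (𝓝 (rotatedSol 0 x)) := by
  refine (tendsto_rotatedSol x).congr' ?_
  filter_upwards [eventually_mem_Ioc_zero_one] with δ hδ using
    (osc_eq_rotatedSol hδ.1 hδ.2 x).symm

theorem continuous_rotatedSol {n : ℕ} {δ : ℝ} (h0 : 0 ≤ δ) (h1 : δ ≤ 1) :
    Continuous (rotatedSol δ : E n → ℂ) := by
  refine continuous_const.mul (continuous_iff_continuousAt.2 fun x => ?_)
  obtain ⟨M, hM, hb⟩ := exists_norm_cexp_cphase_rotated_le n (‖x‖ + 1) (by positivity)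
  refine continuousAt_of_dominated
    (.of_forall fun y => (by fun_prop : Continuous _).aestronglyMeasurable) ?_
    (integrable_exp_neg_norm_sq.const_mul M)
    (.of_forall fun h => (by fun_prop : Continuous _).continuousAt)
  filter_upwards [(continuous_norm.tendsto x).eventually_lt_const (lt_add_one ‖x‖)] with y hy
  exact .of_forall fun h => hb δ y h h0 h1 hy.le

theorem exists_norm_osc_one_le (n : ℕ) : ∃ C > 0, ∀ {δ : ℝ}, 0 < δ → δ ≤ 1 →
    ∀ x : E n, ‖osc 1 0 δ 0 x‖ ≤ C := by
  obtain ⟨C, hC, hb⟩ := exists_norm_osc_le n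
  refine ⟨C, hC, fun {δ} hδ hδ1 x => ?_⟩
  simpa using hb one_pos le_rfl hδ hδ1 0 x

theorem exists_norm_rotatedSol_le (n : ℕ) : ∃ C > 0, ∀ x : E n, ‖rotatedSol 0 x‖ ≤ C := by
  obtain ⟨C, hC, hb⟩ := exists_norm_osc_one_le n
  refine ⟨C, hC, fun x => le_of_tendsto (tendsto_osc x).norm ?_⟩
  filter_upwards [eventually_mem_Ioc_zero_one] with δ hδ using hb hδ.1 hδ.2 x

/-- By Fubini, a cutoff in frequency is an average over translations in space, and dilating the
cutoff by `ε` shrinks these translations. -/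
theorem integral_cexp_mul_comp_smul_eq {n : ℕ} {δ : ℝ} (hδ : 0 < δ) (x : E n)
    (θ : E n → ℂ) (hθ : Integrable θ) (ε : ℝ) :
    ∫ ξ : E n, Complex.exp (Complex.I * (1 + Complex.I * δ) * ((‖ξ‖ ^ 4 : ℝ) : ℂ) +
      Complex.I * (inner ℝ ξ x : ℝ)) *
      (∫ y, Complex.exp (-(2 * Real.pi * inner ℝ y (ε • ξ) : ℝ) * Complex.I) * θ y) =
    ∫ y, θ y * osc 1 0 δ 0 (x - (2 * Real.pi * ε) • y) := by
  have hf : Integrable fun ξ : E n => Real.exp (-δ * ‖ξ‖ ^ 4) := integrable_exp_neg_norm_pow_four hδ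
  simp_rw [← integral_const_mul]
  rw [integral_integral_swap]
  · refine integral_congr_ae (.of_forall fun y => ?_)
    simp only [osc]
    rw [← integral_const_mul]
    refine integral_congr_ae (.of_forall fun ξ => ?_)
    simp only [one_mul, zero_mul, add_zero, inner_sub_right, inner_smul_right,
      real_inner_comm ξ y]
    rw [← mul_assoc, ← Complex.exp_add, mul_comm]
    congr 2
    push_cast
    ring
  · refine (hf.mul_prod hθ.norm).mono' ?_ (.of_forall fun p => ?_)
    · refine ((by fun_prop : Continuous _).aestronglyMeasurable).mul
        (((by fun_prop : Continuous _).aestronglyMeasurable).mul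
          hθ.aestronglyMeasurable.comp_snd)
    · have h1 := norm_cexp_osc_le (A := 1) (B := 0) le_rfl hδ.le p.1 0 x
      simp only [one_mul, zero_mul, add_zero, mul_one] at h1
      simp only [Function.uncurry, norm_mul, ← Complex.ofReal_neg, Complex.norm_exp_ofReal_mul_I,
        one_mul]
      gcongr

/-- With `φ = θ̂`, the cut-off integral is the average of `rotatedSol 0` over the points `x - 2πεy`
against `θ(y)`, first for `δ > 0` and then in the limit `δ → 0`. As `ε → 0`, boundedness and
continuity give `rotatedSol 0 x` times `∫ θ = φ(0) = 1`. -/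
theorem isOscillatoryIntegral_rotatedSol {n : ℕ} (x : E n) :
    IsOscillatoryIntegral (phase x) (rotatedSol 0 x) := by
  intro φ hφ
  obtain ⟨C, hC, hbd⟩ := exists_norm_osc_one_le n
  obtain ⟨C', hC', hbd'⟩ := exists_norm_rotatedSol_le n
  set θ : 𝓢(E n, ℂ) := FourierTransform.fourierInv φ with hθ
  have hθφ (ξ : E n) :
      φ ξ = ∫ y, Complex.exp (-(2 * Real.pi * inner ℝ y ξ : ℝ) * Complex.I) * θ y := by
    have h1 : FourierTransform.fourier θ = φ := FourierTransform.fourier_fourierInv_eq φ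
    conv_lhs => rw [← h1]
    rw [SchwartzMap.fourier_coe, Real.fourier_eq']
    simp [smul_eq_mul]
  have hcont := continuous_rotatedSol (n := n) le_rfl zero_le_one
  have key : ∀ ε : ℝ, 0 < ε →
      ∫ ξ : E n, Complex.exp (Complex.I * (phase x ξ : ℂ)) * φ (ε • ξ) =
        ∫ y, θ y * rotatedSol 0 (x - (2 * Real.pi * ε) • y) := by
    intro ε hε
    have hφε : Integrable fun ξ : E n => φ (ε • ξ) := φ.integrable.comp_smul hε.ne'
    have hL : Tendsto (fun δ : ℝ => ∫ ξ : E n,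
        Complex.exp (Complex.I * (1 + Complex.I * δ) * ((‖ξ‖ ^ 4 : ℝ) : ℂ) +
          Complex.I * (inner ℝ ξ x : ℝ)) * φ (ε • ξ)) (𝓝[>] 0)
        (𝓝 (∫ ξ : E n, Complex.exp (Complex.I * (phase x ξ : ℂ)) * φ (ε • ξ))) := by
      refine tendsto_integral_filter_of_dominated_convergence (fun ξ => ‖φ (ε • ξ)‖)
        (.of_forall fun δ => ?_) ?_ hφε.norm (.of_forall fun ξ => ?_)
      · exact ((by fun_prop : Continuous _).aestronglyMeasurable).mul hφε.aestronglyMeasurable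
      · filter_upwards [eventually_mem_Ioc_zero_one] with δ hδ
        refine .of_forall fun ξ => ?_
        rw [norm_mul]
        refine mul_le_of_le_one_left (norm_nonneg _) ?_
        have h1 := norm_cexp_osc_le (A := 1) (B := 0) le_rfl hδ.1.le ξ 0 x
        simp only [one_mul, zero_mul, add_zero, mul_one] at h1
        refine h1.trans (Real.exp_le_one_iff.2 ?_)
        have : 0 ≤ δ * ‖ξ‖ ^ 4 := mul_nonneg hδ.1.le (by positivity)
        linarith
      · refine Tendsto.mul_const _ ?_
        have h2 : Complex.I * (phase x ξ : ℂ) =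
            Complex.I * (1 + Complex.I * ((0 : ℝ) : ℂ)) * ((‖ξ‖ ^ 4 : ℝ) : ℂ) +
              Complex.I * (inner ℝ ξ x : ℝ) := by
          simp only [phase]
          push_cast
          ring
        rw [h2]
        exact ((by fun_prop : Continuous fun δ : ℝ =>
          Complex.exp (Complex.I * (1 + Complex.I * δ) * ((‖ξ‖ ^ 4 : ℝ) : ℂ) +
            Complex.I * (inner ℝ ξ x : ℝ))).tendsto 0).mono_left nhdsWithin_le_nhds
    have hR : Tendsto (fun δ : ℝ => ∫ y, θ y * osc 1 0 δ 0 (x - (2 * Real.pi * ε) • y)) (𝓝[>] 0)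
        (𝓝 (∫ y, θ y * rotatedSol 0 (x - (2 * Real.pi * ε) • y))) := by
      refine tendsto_integral_filter_of_dominated_convergence (fun y => ‖θ y‖ * C) ?_ ?_
        (θ.integrable.norm.mul_const C) (.of_forall fun y => (tendsto_osc _).const_mul _)
      · filter_upwards [eventually_mem_Ioc_zero_one] with δ hδ
        simp_rw [osc_eq_rotatedSol hδ.1 hδ.2]
        exact θ.integrable.aestronglyMeasurable.mul
          ((continuous_rotatedSol hδ.1.le hδ.2).comp (by fun_prop)).aestronglyMeasurable
      · filter_upwards [eventually_mem_Ioc_zero_one] with δ hδ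
        refine .of_forall fun y => ?_
        rw [norm_mul]
        gcongr
        exact hbd hδ.1 hδ.2 _
    refine tendsto_nhds_unique hL (hR.congr' ?_)
    filter_upwards [eventually_mem_Ioc_zero_one] with δ hδ
    rw [← integral_cexp_mul_comp_smul_eq hδ.1 x θ θ.integrable ε]
    simp_rw [← hθφ]
  have hlim : Tendsto (fun ε : ℝ => ∫ y, θ y * rotatedSol 0 (x - (2 * Real.pi * ε) • y)) (𝓝[>] 0)
      (𝓝 (∫ y, θ y * rotatedSol 0 x)) := by
    refine tendsto_integral_filter_of_dominated_convergence (fun y => ‖θ y‖ * C')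
      (.of_forall fun ε => θ.integrable.aestronglyMeasurable.mul
        (hcont.comp (by fun_prop)).aestronglyMeasurable)
      (.of_forall fun ε => .of_forall fun y => ?_) (θ.integrable.norm.mul_const C')
      (.of_forall fun y => Tendsto.const_mul _ ?_)
    · rw [norm_mul]
      gcongr
      exact hbd' _
    · have : Tendsto (fun ε : ℝ => x - (2 * Real.pi * ε) • y) (𝓝[>] 0) (𝓝 x) := by
        have h3 := (by fun_prop : Continuous fun ε : ℝ => x - (2 * Real.pi * ε) • y).tendsto 0
        simp only [mul_zero, zero_smul, sub_zero] at h3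
        exact h3.mono_left nhdsWithin_le_nhds
      exact (hcont.tendsto x).comp this
  have hone : ∫ y, θ y = 1 := by
    rw [← hφ, hθφ 0]
    simp
  rw [integral_mul_const, hone, one_mul] at hlim
  refine hlim.congr' ?_
  filter_upwards [self_mem_nhdsWithin] with ε hε using (key ε hε).symm

/-- An admissible test function is what makes the value of an oscillatory integral unique. -/
theorem exists_schwartzMap_apply_zero_eq_one (n : ℕ) : ∃ φ : 𝓢(E n, ℂ), φ 0 = 1 := by
  let b : ContDiffBump (0 : E n) := ⟨1, 2, one_pos, one_lt_two⟩
  have h1 : HasCompactSupport fun x : E n => ((b x : ℝ) : ℂ) :=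
    b.hasCompactSupport.comp_left Complex.ofReal_zero
  have h2 : ContDiff ℝ ∞ fun x : E n => ((b x : ℝ) : ℂ) :=
    Complex.ofRealCLM.contDiff.comp b.contDiff
  refine ⟨h1.toSchwartzMap h2, ?_⟩
  have : b 0 = 1 := b.one_of_mem_closedBall (Metric.mem_closedBall_self zero_le_one)
  change ((b 0 : ℝ) : ℂ) = 1
  rw [this, Complex.ofReal_one]

theorem fundSol_eq_rotatedSol {n : ℕ} (x : E n) : fundSol x = rotatedSol 0 x := by
  have h : ∃ a, IsOscillatoryIntegral (phase x) a := ⟨_, isOscillatoryIntegral_rotatedSol x⟩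
  obtain ⟨φ, hφ⟩ := exists_schwartzMap_apply_zero_eq_one n
  rw [fundSol, oscillatoryIntegral, dif_pos h]
  exact tendsto_nhds_unique (h.choose_spec φ hφ) (isOscillatoryIntegral_rotatedSol x φ hφ)

theorem isOscillatoryIntegral_fundSol {n : ℕ} (x : E n) :
    IsOscillatoryIntegral (phase x) (fundSol x) :=
  fundSol_eq_rotatedSol x ▸ isOscillatoryIntegral_rotatedSol x

theorem continuous_fundSol {n : ℕ} : Continuous (fundSol : E n → ℂ) := by
  rw [show (fundSol : E n → ℂ) = rotatedSol 0 from funext fundSol_eq_rotatedSol]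
  exact continuous_rotatedSol le_rfl zero_le_one

/-! ### The kernel on the Fourier side -/

theorem integral_mul_integral_swap {n : ℕ} {F w : E n → ℂ} (hF : Integrable F) (hw : Integrable w)
    {K : E n → E n → ℂ} (hK : Continuous fun p : E n × E n => K p.1 p.2)
    (hb : ∀ x ξ, ‖K x ξ‖ ≤ 1) :
    ∫ x, w x * ∫ ξ, F ξ * K x ξ = ∫ ξ, F ξ * ∫ x, w x * K x ξ := by
  simp_rw [← integral_const_mul]
  rw [integral_integral_swap]
  · simp_rw [mul_left_comm]
  · refine (hw.norm.mul_prod hF.norm).mono' (hw.aestronglyMeasurable.comp_fst.mul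
      (hF.aestronglyMeasurable.comp_snd.mul hK.aestronglyMeasurable)) (.of_forall fun p => ?_)
    simp only [Function.uncurry, norm_mul]
    gcongr
    exact mul_le_of_le_one_right (norm_nonneg _) (hb _ _)

/-- The unnormalised Fourier transform `∫ w(x) e^{i ⟪k, x⟫} dx`. -/
noncomputable def charTransform {n : ℕ} (w : E n → ℂ) (k : E n) : ℂ :=
  ∫ x, w x * Complex.exp ((inner ℝ k x : ℝ) * Complex.I)

/-- The regularised multiplier `exp (i (1 + i δ) A ‖ξ‖⁴)`. -/
noncomputable def multiplier {n : ℕ} (A δ : ℝ) (ξ : E n) : ℂ :=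
  Complex.exp (Complex.I * (1 + Complex.I * δ) * ((A * ‖ξ‖ ^ 4 : ℝ) : ℂ))

theorem continuous_multiplier {n : ℕ} (A δ : ℝ) : Continuous (multiplier A δ : E n → ℂ) := by
  unfold multiplier
  fun_prop

theorem norm_multiplier {n : ℕ} (A δ : ℝ) (ξ : E n) :
    ‖multiplier A δ ξ‖ = Real.exp (-(δ * A) * ‖ξ‖ ^ 4) := by
  rw [multiplier, Complex.norm_exp, Complex.re_mul_ofReal]
  congr 1
  have h1 : (Complex.I * (1 + Complex.I * δ)).re = -δ := by simp
  rw [h1]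
  ring

theorem norm_multiplier_le_one {n : ℕ} {A δ : ℝ} (hA : 0 ≤ A) (hδ : 0 ≤ δ) (ξ : E n) :
    ‖multiplier A δ ξ‖ ≤ 1 := by
  rw [norm_multiplier]
  refine Real.exp_le_one_iff.2 ?_
  have : 0 ≤ δ * A * ‖ξ‖ ^ 4 := by positivity
  linarith

theorem integrable_multiplier {n : ℕ} {A δ : ℝ} (hA : 0 < A) (hδ : 0 < δ) :
    Integrable (multiplier A δ : E n → ℂ) :=
  (integrable_exp_neg_norm_pow_four (mul_pos hδ hA)).mono'
    (continuous_multiplier A δ).aestronglyMeasurable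
    (.of_forall fun ξ => (norm_multiplier A δ ξ).le)

theorem osc_eq_integral_multiplier {n : ℕ} (A B δ : ℝ) (ζ v : E n) :
    osc A B δ ζ v = ∫ ξ, multiplier A δ ξ *
      (multiplier B δ (ξ - ζ) * Complex.exp ((inner ℝ ξ v : ℝ) * Complex.I)) := by
  refine integral_congr_ae (.of_forall fun ξ => ?_)
  simp only [multiplier]
  rw [← Complex.exp_add, ← Complex.exp_add]
  congr 1
  push_cast
  ring

theorem osc_zero_eq {n : ℕ} (A δ : ℝ) (v : E n) :
    osc A 0 δ 0 v = ∫ ξ, multiplier A δ ξ * Complex.exp ((inner ℝ ξ v : ℝ) * Complex.I) := by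
  rw [osc_eq_integral_multiplier]
  simp [multiplier]

theorem continuous_osc_zero {n : ℕ} {A δ : ℝ} (hA : 0 < A) (hδ : 0 < δ) :
    Continuous fun v : E n => osc A 0 δ 0 v := by
  have hc := continuous_multiplier (n := n) A δ
  simp_rw [osc_zero_eq]
  refine continuous_of_dominated (bound := fun ξ => ‖multiplier A δ ξ‖)
    (fun v => (by fun_prop : Continuous _).aestronglyMeasurable)
    (fun v => .of_forall fun ξ => ?_) (integrable_multiplier hA hδ).norm
    (.of_forall fun ξ => by fun_prop)
  rw [norm_mul, Complex.norm_exp_ofReal_mul_I, mul_one]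

/-- The regularised interaction kernel in terms of the transform of the cutoff. -/
theorem integral_osc_mul_osc_mul {n : ℕ} {A B δ : ℝ} (hA : 0 < A) (hB : 0 < B) (hδ : 0 < δ)
    (hδ1 : δ ≤ 1) {w : E n → ℂ} (hw : Integrable w) (hW : Integrable (charTransform w))
    (y z : E n) :
    ∫ x, osc A 0 δ 0 (x - y) * osc B 0 δ 0 (x - z) * w x =
      ∫ k, charTransform w k *
        (Complex.exp (((-inner ℝ k z : ℝ) : ℂ) * Complex.I) * osc A B δ k (z - y)) := by
  obtain ⟨C, hC, hbd⟩ := exists_norm_osc_le n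
  have hcA := continuous_multiplier (n := n) A δ
  have hcB := continuous_multiplier (n := n) B δ
  have hFA := integrable_multiplier (n := n) hA hδ
  have hFB := integrable_multiplier (n := n) hB hδ
  have hBw : Integrable fun x => osc B 0 δ 0 (x - z) * w x :=
    hw.bdd_mul ((continuous_osc_zero hB hδ).comp (by fun_prop)).aestronglyMeasurable
      (.of_forall fun x => hbd hB le_rfl hδ hδ1 0 (x - z))
  calc _ = ∫ x, (osc B 0 δ 0 (x - z) * w x) *
        ∫ ξ, multiplier A δ ξ * Complex.exp ((inner ℝ ξ (x - y) : ℝ) * Complex.I) := by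
        simp_rw [← osc_zero_eq]
        exact integral_congr_ae (.of_forall fun x => by ring)
    _ = ∫ ξ, multiplier A δ ξ * ∫ x, (osc B 0 δ 0 (x - z) * w x) *
        Complex.exp ((inner ℝ ξ (x - y) : ℝ) * Complex.I) :=
        integral_mul_integral_swap hFA hBw
          (K := fun x ξ => Complex.exp ((inner ℝ ξ (x - y) : ℝ) * Complex.I)) (by fun_prop)
          fun x ξ => (Complex.norm_exp_ofReal_mul_I _).le
    _ = ∫ ξ, multiplier A δ ξ * ∫ k, charTransform w k * (multiplier B δ (ξ - k) *
        Complex.exp (((inner ℝ ξ (z - y) - inner ℝ k z : ℝ) : ℂ) * Complex.I)) := by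
        refine integral_congr_ae (.of_forall fun ξ => ?_)
        simp only
        congr 1
        have hwξ : Integrable fun x =>
            w x * Complex.exp ((inner ℝ ξ (x - y) : ℝ) * Complex.I) :=
          hw.mul_bdd (c := 1) (by fun_prop : Continuous _).aestronglyMeasurable
            (.of_forall fun x => (Complex.norm_exp_ofReal_mul_I _).le)
        have h1 := integral_mul_integral_swap hFB hwξ
          (K := fun x η => Complex.exp ((inner ℝ η (x - z) : ℝ) * Complex.I)) (by fun_prop)
          fun x ξ => (Complex.norm_exp_ofReal_mul_I _).le
        simp_rw [← osc_zero_eq] at h1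
        calc _ = ∫ x, w x * Complex.exp ((inner ℝ ξ (x - y) : ℝ) * Complex.I) *
              osc B 0 δ 0 (x - z) := integral_congr_ae (.of_forall fun x => by ring)
          _ = ∫ η, multiplier B δ η * (charTransform w (ξ + η) *
              Complex.exp (((-inner ℝ ξ y - inner ℝ η z : ℝ) : ℂ) * Complex.I)) := by
              rw [h1]
              refine integral_congr_ae (.of_forall fun η => ?_)
              simp only [charTransform]
              rw [← integral_mul_const]
              congr 1
              refine integral_congr_ae (.of_forall fun x => ?_)
              simp only [inner_sub_right, inner_add_left]
              rw [mul_assoc, mul_assoc, ← Complex.exp_add, ← Complex.exp_add]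
              congr 2
              push_cast
              ring
          _ = _ := by
              -- Substitution `η = k - ξ`; the multiplier is even, so `k - ξ` may be replaced by `ξ
              -- - k`.
              rw [← integral_add_left_eq_self _ (-ξ)]
              refine integral_congr_ae (.of_forall fun k => ?_)
              have h2 : multiplier B δ (-ξ + k) = multiplier B δ (ξ - k) := by
                rw [multiplier, multiplier, ← norm_neg (ξ - k), neg_sub, neg_add_eq_sub]
              simp only [h2, add_neg_cancel_left, inner_add_left, inner_neg_left, inner_sub_right]
              rw [mul_left_comm]
              congr 4
              push_cast
              ring
    _ = ∫ k, charTransform w k * ∫ ξ, multiplier A δ ξ * (multiplier B δ (ξ - k) *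
        Complex.exp (((inner ℝ ξ (z - y) - inner ℝ k z : ℝ) : ℂ) * Complex.I)) := by
        refine (integral_mul_integral_swap hFA hW (K := fun k ξ => multiplier B δ (ξ - k) *
          Complex.exp (((inner ℝ ξ (z - y) - inner ℝ k z : ℝ) : ℂ) * Complex.I)) (by fun_prop)
          fun k ξ => ?_).symm
        rw [norm_mul, Complex.norm_exp_ofReal_mul_I, mul_one]
        exact norm_multiplier_le_one hB.le hδ.le _
    _ = _ := by
        refine integral_congr_ae (.of_forall fun k => ?_)
        simp only [osc_eq_integral_multiplier A B]
        refine congrArg (charTransform w k * ·) ?_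
        rw [← integral_const_mul]
        refine integral_congr_ae (.of_forall fun ξ => ?_)
        simp only
        have h3 : Complex.exp (((inner ℝ ξ (z - y) - inner ℝ k z : ℝ) : ℂ) * Complex.I) =
            Complex.exp (((-inner ℝ k z : ℝ) : ℂ) * Complex.I) *
              Complex.exp ((inner ℝ ξ (z - y) : ℝ) * Complex.I) := by
          rw [← Complex.exp_add]
          push_cast
          ring_nf
        rw [h3]
        ring

theorem continuous_osc_left {n : ℕ} {A B δ : ℝ} (hA : 0 < A) (hB : 0 ≤ B) (hδ : 0 < δ) (v : E n) :
    Continuous fun k : E n => osc A B δ k v := by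
  have hcA := continuous_multiplier (n := n) A δ
  have hcB := continuous_multiplier (n := n) B δ
  simp_rw [osc_eq_integral_multiplier]
  refine continuous_of_dominated (bound := fun ξ => ‖multiplier A δ ξ‖)
    (fun k => (by fun_prop : Continuous _).aestronglyMeasurable)
    (fun k => .of_forall fun ξ => ?_) (integrable_multiplier hA hδ).norm
    (.of_forall fun ξ => by fun_prop)
  rw [norm_mul, norm_mul, Complex.norm_exp_ofReal_mul_I, mul_one]
  exact mul_le_of_le_one_right (norm_nonneg _) (norm_multiplier_le_one hB hδ.le _)

/-- Parabolic-type scaling `ξ ↦ aξ`: with `a` the fourth root of the elapsed time, the factor `aⁿ`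
cancels the prefactor in the kernel. -/
theorem osc_smul {n : ℕ} {a : ℝ} (ha : 0 < a) (δ : ℝ) (x : E n) :
    osc 1 0 δ 0 (a⁻¹ • x) = (a : ℂ) ^ n * osc (a ^ 4) 0 δ 0 x := by
  have h1 := Measure.integral_comp_smul_of_nonneg (volume : Measure (E n))
    (fun ξ => multiplier 1 δ ξ * Complex.exp ((inner ℝ ξ (a⁻¹ • x) : ℝ) * Complex.I)) a
    (hR := ha.le)
  have ha0 : (a : ℂ) ≠ 0 := by exact_mod_cast ha.ne'
  rw [← osc_zero_eq, finrank_euclideanSpace_fin, Complex.real_smul] at h1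
  have h2 : ∀ ξ : E n, multiplier 1 δ (a • ξ) *
      Complex.exp ((inner ℝ (a • ξ) (a⁻¹ • x) : ℝ) * Complex.I) =
      multiplier (a ^ 4) δ ξ * Complex.exp ((inner ℝ ξ x : ℝ) * Complex.I) := by
    intro ξ
    rw [real_inner_smul_left, inner_smul_right, mul_inv_cancel_left₀ ha.ne', multiplier,
      multiplier, norm_smul, Real.norm_of_nonneg ha.le, mul_pow, one_mul]
  simp_rw [h2, ← osc_zero_eq] at h1
  rw [h1]
  push_cast
  field_simp

/-! ### The Fourier transform of the cutoff -/

theorem charTransform_eq_fourier {n : ℕ} (w : E n → ℂ) (k : E n) :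
    charTransform w k = FourierTransform.fourier w (-(2 * Real.pi)⁻¹ • k) := by
  rw [Real.fourier_eq', charTransform]
  refine integral_congr_ae (.of_forall fun x => ?_)
  simp only [smul_eq_mul]
  rw [mul_comm, inner_smul_right, real_inner_comm k x]
  congr 3
  field_simp

theorem integral_norm_iteratedFDeriv_le {n : ℕ} {u : E n → ℂ} {S : Set (E n)} (hS : IsCompact S)
    (hsupp : ∀ x ∉ S, u x = 0) {j : ℕ} {b : ℝ} (hb : ∀ x, ‖iteratedFDeriv ℝ j u x‖ ≤ b) :
    ∫ x, ‖iteratedFDeriv ℝ j u x‖ ≤ b * volume.real S := by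
  have hts : tsupport u ⊆ S :=
    closure_minimal (fun x hx => by_contra fun h => hx (hsupp x h)) hS.isClosed
  have hle : ∀ x, ‖iteratedFDeriv ℝ j u x‖ ≤ S.indicator (fun _ => b) x := by
    intro x
    by_cases hx : x ∈ S
    · rw [Set.indicator_of_mem hx]
      exact hb x
    · rw [Set.indicator_of_notMem hx, norm_le_zero_iff]
      by_contra h
      exact hx (hts (support_iteratedFDeriv_subset j h))
  have hint : Integrable (S.indicator fun _ : E n => b) :=
    (integrable_indicator_iff hS.measurableSet).2 (integrableOn_const hS.measure_ne_top)
  calc _ ≤ ∫ x, S.indicator (fun _ => b) x :=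
        integral_mono_of_nonneg (.of_forall fun x => norm_nonneg _) hint (.of_forall hle)
    _ = _ := by rw [integral_indicator_const b hS.measurableSet, smul_eq_mul, mul_comm]

/-- Derivatives trade for powers of frequency, and their `L¹` norms are at most the sup norm times
the volume of `S`. That volume is where the number of points enters. -/
theorem one_add_pow_mul_norm_charTransform_le {n : ℕ} {u : E n → ℂ} (hu : ContDiff ℝ ∞ u)
    {S : Set (E n)} (hS : IsCompact S) (hsupp : ∀ x ∉ S, u x = 0) {b : ℕ → ℝ}
    (hb : ∀ j x, ‖iteratedFDeriv ℝ j u x‖ ≤ b j) (m : ℕ) (k : E n) :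
    (1 + ‖k‖) ^ m * ‖charTransform u k‖ ≤
      2 ^ m * (b 0 + (2 * Real.pi) ^ m * (2 ^ m * ∑ j ∈ Finset.range (m + 1), b j)) *
        volume.real S := by
  have hcs : HasCompactSupport u := .intro hS hsupp
  have hint : ∀ j : ℕ, Integrable fun v => ‖iteratedFDeriv ℝ j u v‖ := fun j =>
    ((hu.continuous_iteratedFDeriv (m := j) (by exact_mod_cast le_top)).integrable_of_hasCompactSupport
      (hcs.iteratedFDeriv j)).norm
  set ζ := -(2 * Real.pi)⁻¹ • k with hζ
  have hk : ‖k‖ = 2 * Real.pi * ‖ζ‖ := by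
    rw [hζ, norm_smul, norm_neg, norm_inv, Real.norm_of_nonneg Real.two_pi_pos.le,
      mul_inv_cancel_left₀ Real.two_pi_pos.ne']
  have hpow : ∀ i : ℕ, ‖ζ‖ ^ i * ‖charTransform u k‖ ≤
      2 ^ i * ((∑ j ∈ Finset.range (i + 1), b j) * volume.real S) := by
    intro i
    have h1 := Real.pow_mul_norm_iteratedFDeriv_fourier_le (K := 0) (N := ⊤) (k := 0) (n := i)
      (f := u) (by exact_mod_cast hu) (fun k' j hk' _ => by
        have : k' = 0 := by simpa using hk'
        subst this
        simpa using hint j) le_rfl le_top ζ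
    rw [norm_iteratedFDeriv_zero, ← charTransform_eq_fourier] at h1
    refine h1.trans ?_
    simp only [pow_zero, one_mul, CharP.cast_eq_zero, mul_zero, zero_add, Finset.range_one,
      Finset.sum_product, Finset.sum_singleton]
    gcongr
    rw [Finset.sum_mul]
    exact Finset.sum_le_sum fun j _ => integral_norm_iteratedFDeriv_le hS hsupp (hb j)
  have h0 := hpow 0
  simp only [pow_zero, one_mul, zero_add, Finset.range_one, Finset.sum_singleton] at h0
  have h1 : (1 + ‖k‖) ^ m ≤ 2 ^ m * (1 + ‖k‖ ^ m) := by
    rcases le_total ‖k‖ 1 with h | h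
    · calc (1 + ‖k‖) ^ m ≤ 2 ^ m := by gcongr; linarith
        _ ≤ _ := le_mul_of_one_le_right (by positivity) (by
          have : 0 ≤ ‖k‖ ^ m := by positivity
          linarith)
    · calc (1 + ‖k‖) ^ m ≤ (2 * ‖k‖) ^ m := by gcongr; linarith
        _ = 2 ^ m * ‖k‖ ^ m := mul_pow _ _ _
        _ ≤ _ := by gcongr; linarith
  calc _ ≤ 2 ^ m * (1 + ‖k‖ ^ m) * ‖charTransform u k‖ := by gcongr
    _ = 2 ^ m * (‖charTransform u k‖ + (2 * Real.pi) ^ m * (‖ζ‖ ^ m * ‖charTransform u k‖)) := by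
      rw [hk]
      ring
    _ ≤ 2 ^ m * (b 0 * volume.real S + (2 * Real.pi) ^ m *
        (2 ^ m * ((∑ j ∈ Finset.range (m + 1), b j) * volume.real S))) := by
      have := Real.two_pi_pos
      exact mul_le_mul_of_nonneg_left (add_le_add h0
        (mul_le_mul_of_nonneg_left (hpow m) (by positivity))) (by positivity)
    _ = _ := by ring

/-- The weight `1 - χ̃²` as a complex function. -/
noncomputable def weight {n : ℕ} (χ : E n → ℝ) (x : E n) : ℂ := ((1 - compl χ x ^ 2 : ℝ) : ℂ)

theorem weight_eq {n : ℕ} (χ : E n → ℝ) (x : E n) :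
    weight χ x = ((χ x * (2 - χ x) : ℝ) : ℂ) := by
  rw [weight, compl]
  congr 1
  ring

/-- A bound for the derivatives of `χ (2 - χ)` at unit scale. -/
noncomputable def weightBound (A : ℕ → ℝ) (m : ℕ) : ℝ :=
  ∑ i ∈ Finset.range (m + 1), (m.choose i : ℝ) * |A i| * (2 + |A (m - i)|)

theorem weightBound_nonneg (A : ℕ → ℝ) (m : ℕ) : 0 ≤ weightBound A m :=
  Finset.sum_nonneg fun i _ => by positivity

namespace IsCutoff

variable {n J : ℕ} {A : ℕ → ℝ} {p : Fin J → E n} {μ : ℝ} {χ : E n → ℝ}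

theorem contDiff_weight (h : IsCutoff A p μ χ) : ContDiff ℝ ∞ (weight χ) := by
  have h1 := h.smooth
  rw [show weight χ = fun x => Complex.ofRealCLM (χ x * (2 - χ x)) from funext (weight_eq χ)]
  fun_prop

theorem weight_eq_zero (h : IsCutoff A p μ χ) {x : E n}
    (hx : x ∉ ⋃ j, Metric.closedBall (p j) (2 * μ⁻¹)) : weight χ x = 0 := by
  rw [weight_eq, h.eq_zero x ?_, zero_mul, Complex.ofReal_zero]
  refine le_iInf fun j => ?_
  simp only [Set.mem_iUnion, not_exists, Metric.mem_closedBall, not_le] at hx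
  rw [edist_dist]
  exact ENNReal.ofReal_le_ofReal (hx j).le

theorem isCompact_iUnion_closedBall (p : Fin J → E n) (r : ℝ) :
    IsCompact (⋃ j, Metric.closedBall (p j) r) :=
  isCompact_iUnion fun j => isCompact_closedBall (p j) r

theorem integrable_weight (h : IsCutoff A p μ χ) : Integrable (weight χ) :=
  h.contDiff_weight.continuous.integrable_of_hasCompactSupport
    (.intro (isCompact_iUnion_closedBall p _) fun _ hx => h.weight_eq_zero hx)

theorem norm_iteratedFDeriv_comp_smul_le (hμ : 0 < μ) (h : IsCutoff A p μ χ) (m : ℕ) (x : E n) :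
    ‖iteratedFDeriv ℝ m (fun x => χ (μ⁻¹ • x)) x‖ ≤ |A m| := by
  rw [iteratedFDeriv_comp_const_smul μ⁻¹ (h.smooth.of_le (by exact_mod_cast le_top)), norm_smul,
    norm_pow, norm_inv, Real.norm_of_nonneg hμ.le]
  calc _ ≤ μ⁻¹ ^ m * (A m * μ ^ m) := by gcongr; exact h.deriv_le m _
    _ = A m := by rw [mul_left_comm, ← mul_pow, inv_mul_cancel₀ hμ.ne', one_pow, mul_one]
    _ ≤ _ := le_abs_self _

theorem norm_iteratedFDeriv_weight_le (hμ : 0 < μ) (h : IsCutoff A p μ χ) (m : ℕ) (x : E n) :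
    ‖iteratedFDeriv ℝ m (fun x => weight χ (μ⁻¹ • x)) x‖ ≤ weightBound A m := by
  have hχ : ContDiff ℝ ∞ fun x => χ (μ⁻¹ • x) := h.smooth.comp (contDiff_const_smul _)
  have h2 : ContDiff ℝ ∞ fun x => 2 - χ (μ⁻¹ • x) := contDiff_const.sub hχ
  have hle (j : ℕ) : ((j : ℕ∞) : WithTop ℕ∞) ≤ ((⊤ : ℕ∞) : WithTop ℕ∞) := by exact_mod_cast le_top
  have e : (fun x => weight χ (μ⁻¹ • x)) =
      Complex.ofRealLI ∘ fun x => χ (μ⁻¹ • x) * (2 - χ (μ⁻¹ • x)) :=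
    funext fun x => weight_eq χ _
  rw [e, Complex.ofRealLI.norm_iteratedFDeriv_comp_left (hχ.mul h2).contDiffAt (hle m)]
  refine (norm_iteratedFDeriv_mul_le hχ h2 x (hle m)).trans (Finset.sum_le_sum fun i _ => ?_)
  gcongr
  · exact h.norm_iteratedFDeriv_comp_smul_le hμ i x
  · have e2 : iteratedFDeriv ℝ (m - i) (fun x => 2 - χ (μ⁻¹ • x)) x =
        iteratedFDeriv ℝ (m - i) (fun _ => (2 : ℝ)) x -
          iteratedFDeriv ℝ (m - i) (fun x => χ (μ⁻¹ • x)) x :=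
      iteratedFDeriv_sub_apply contDiffAt_const (hχ.of_le (hle _)).contDiffAt
    rw [e2]
    refine (norm_sub_le _ _).trans (add_le_add ?_ (h.norm_iteratedFDeriv_comp_smul_le hμ _ x))
    rcases Nat.eq_zero_or_pos (m - i) with h0 | h0
    · rw [h0, norm_iteratedFDeriv_zero]
      norm_num
    · rw [iteratedFDeriv_const_of_ne h0.ne']
      simp

theorem norm_weight_apply_le (hμ : 0 < μ) (h : IsCutoff A p μ χ) (x : E n) :
    ‖weight χ x‖ ≤ weightBound A 0 := by
  have := h.norm_iteratedFDeriv_weight_le hμ 0 (μ • x)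
  rwa [norm_iteratedFDeriv_zero, inv_smul_smul₀ hμ.ne'] at this

end IsCutoff

/-- The constant in the decay estimate for the transform of the cutoff. -/
noncomputable def transformConst (n : ℕ) (A : ℕ → ℝ) : ℝ :=
  2 ^ (n + 2) * (weightBound A 0 + (2 * Real.pi) ^ (n + 2) *
    (2 ^ (n + 2) * ∑ j ∈ Finset.range (n + 2 + 1), weightBound A j)) *
    volume.real (Metric.closedBall (0 : E n) 2)

theorem transformConst_nonneg (n : ℕ) (A : ℕ → ℝ) : 0 ≤ transformConst n A := by
  have h0 := weightBound_nonneg A 0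
  have h1 := Finset.sum_nonneg fun j (_ : j ∈ Finset.range (n + 2 + 1)) => weightBound_nonneg A j
  have h2 := Real.two_pi_pos
  unfold transformConst
  positivity

theorem charTransform_comp_smul {n : ℕ} {μ : ℝ} (hμ : 0 < μ) (w : E n → ℂ) (k : E n) :
    charTransform w k =
      ((μ ^ n)⁻¹ : ℝ) • charTransform (fun x => w (μ⁻¹ • x)) (μ⁻¹ • k) := by
  have h1 := Measure.integral_comp_smul_of_nonneg (volume : Measure (E n))
    (fun x => w (μ⁻¹ • x) * Complex.exp ((inner ℝ (μ⁻¹ • k) x : ℝ) * Complex.I)) μ (hR := hμ.le)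
  rw [finrank_euclideanSpace_fin] at h1
  rw [charTransform, charTransform, ← h1]
  refine integral_congr_ae (.of_forall fun x => ?_)
  simp only [inv_smul_smul₀ hμ.ne', real_inner_smul_left, inner_smul_right,
    mul_inv_cancel_left₀ hμ.ne']

theorem measureReal_iUnion_closedBall_le {n J : ℕ} (p : Fin J → E n) :
    volume.real (⋃ j, Metric.closedBall (p j) 2) ≤
      J * volume.real (Metric.closedBall (0 : E n) 2) := by
  refine (measureReal_iUnion_fintype_le _).trans ?_
  have : ∀ j, volume.real (Metric.closedBall (p j) 2) =
      volume.real (Metric.closedBall (0 : E n) 2) := fun j => by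
    rw [measureReal_def, measureReal_def, Measure.addHaar_closedBall_center]
  simp [this]

/-- Rescaling by `μ` reduces to unit scale, with support in `J` balls of radius `2`. Of the `n + 2`
powers, `n + 1` secure integrability and one is reserved for the factor `‖k‖`. -/
theorem IsCutoff.norm_charTransform_le {n J : ℕ} {A : ℕ → ℝ} {p : Fin J → E n} {μ : ℝ}
    {χ : E n → ℝ} (hμ : 0 < μ) (h : IsCutoff A p μ χ) (k : E n) :
    (1 + ‖μ⁻¹ • k‖) ^ (n + 2) * ‖charTransform (weight χ) k‖ ≤
      (μ ^ n)⁻¹ * (transformConst n A * J) := by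
  have hu : ContDiff ℝ ∞ fun x => weight χ (μ⁻¹ • x) :=
    h.contDiff_weight.comp (contDiff_const_smul _)
  have h1 := one_add_pow_mul_norm_charTransform_le hu
    (IsCutoff.isCompact_iUnion_closedBall (fun j => μ • p j) 2) (fun x hx => by
      refine h.weight_eq_zero fun hx' => hx ?_
      simp only [Set.mem_iUnion, Metric.mem_closedBall] at hx' ⊢
      obtain ⟨j, hj⟩ := hx'
      refine ⟨j, ?_⟩
      have h2 : x = μ • μ⁻¹ • x := (smul_inv_smul₀ hμ.ne' x).symm
      rw [h2, dist_smul₀, Real.norm_of_nonneg hμ.le]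
      calc _ ≤ μ * (2 * μ⁻¹) := by gcongr
        _ = 2 := by field_simp)
    (fun j x => h.norm_iteratedFDeriv_weight_le hμ j x) (n + 2) (μ⁻¹ • k)
  have h3 := measureReal_iUnion_closedBall_le fun j => μ • p j
  rw [charTransform_comp_smul hμ, norm_smul (_ : ℝ) (charTransform _ _),
    Real.norm_of_nonneg (by positivity), mul_left_comm ((1 + ‖μ⁻¹ • k‖) ^ (n + 2))]
  refine mul_le_mul_of_nonneg_left (h1.trans ?_) (by positivity)
  rw [transformConst, mul_assoc _ _ (J : ℝ), mul_comm _ (J : ℝ)]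
  have h0 := weightBound_nonneg A 0
  have h4 := Finset.sum_nonneg fun j (_ : j ∈ Finset.range (n + 2 + 1)) => weightBound_nonneg A j
  have h5 := Real.two_pi_pos
  gcongr

theorem integrable_one_add_norm_rpow (n : ℕ) :
    Integrable fun k : E n => (1 + ‖k‖) ^ (-(n + 1 : ℝ)) :=
  integrable_one_add_norm (by simp)

/-- Weighted integrability of the transform of the cutoff. -/
theorem exists_integral_charTransform_le (n : ℕ) (A : ℕ → ℝ) : ∃ C > 0, ∀ {J : ℕ}
    {p : Fin J → E n} {μ : ℝ} {χ : E n → ℝ}, 0 < μ → IsCutoff A p μ χ →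
    ∃ g : E n → ℝ, Integrable g ∧ (∀ k, ‖charTransform (weight χ) k‖ ≤ g k) ∧
      (∀ k, ‖k‖ * ‖charTransform (weight χ) k‖ ≤ μ * g k) ∧ ∫ k, g k ≤ C * J := by
  set I₀ := ∫ k : E n, (1 + ‖k‖) ^ (-(n + 1 : ℝ)) with hI
  have hI0 : 0 ≤ I₀ := integral_nonneg fun k => by positivity
  have hT := transformConst_nonneg n A
  refine ⟨transformConst n A * I₀ + 1, by positivity, fun {J p μ χ} hμ h => ?_⟩
  have hk (k : E n) :
      (1 + ‖μ⁻¹ • k‖) ^ (-(n + 1 : ℝ)) = ((1 + ‖μ⁻¹ • k‖) ^ (n + 1))⁻¹ := by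
    rw [Real.rpow_neg (by positivity), ← Real.rpow_natCast]
    push_cast
    rfl
  refine ⟨fun k => (μ ^ n)⁻¹ * (transformConst n A * J) * (1 + ‖μ⁻¹ • k‖) ^ (-(n + 1 : ℝ)),
    ((integrable_one_add_norm_rpow n).comp_smul (inv_ne_zero hμ.ne')).const_mul _, ?_, ?_, ?_⟩
  · intro k
    simp only [hk]
    rw [← div_eq_mul_inv, le_div_iff₀ (by positivity), mul_comm]
    refine le_trans ?_ (h.norm_charTransform_le hμ k)
    gcongr
    · linarith [norm_nonneg (μ⁻¹ • k)]
    · omega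
  · intro k
    simp only [hk]
    rw [← div_eq_mul_inv, ← mul_div_assoc, le_div_iff₀ (by positivity)]
    have h1 : ‖k‖ = μ * ‖μ⁻¹ • k‖ := by
      rw [norm_smul, norm_inv, Real.norm_of_nonneg hμ.le, mul_inv_cancel_left₀ hμ.ne']
    calc _ = μ * (‖μ⁻¹ • k‖ * (1 + ‖μ⁻¹ • k‖) ^ (n + 1) * ‖charTransform (weight χ) k‖) := by
          rw [h1]
          ring
      _ ≤ μ * ((1 + ‖μ⁻¹ • k‖) ^ (n + 2) * ‖charTransform (weight χ) k‖) := by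
          gcongr
          rw [pow_succ' _ (n + 1)]
          gcongr
          linarith
      _ ≤ _ := by
          exact mul_le_mul_of_nonneg_left (h.norm_charTransform_le hμ k) hμ.le
  · have h1 := Measure.integral_comp_inv_smul_of_nonneg (volume : Measure (E n))
      (fun k => (1 + ‖k‖) ^ (-(n + 1 : ℝ))) (R := μ) hμ.le
    rw [integral_const_mul, h1, finrank_euclideanSpace_fin, ← hI, smul_eq_mul]
    have h2 : (μ ^ n)⁻¹ * (transformConst n A * J) * (μ ^ n * I₀) =
        transformConst n A * I₀ * J := by
      field_simp
    rw [h2]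
    gcongr
    linarith

/-- Fourier inversion for `charTransform`. -/
theorem norm_integral_charTransform_mul {n : ℕ} {w : E n → ℂ} (hc : Continuous w)
    (hw : Integrable w) (hW : Integrable (charTransform w)) (z : E n) :
    ‖∫ k, charTransform w k * Complex.exp (((-inner ℝ k z : ℝ) : ℂ) * Complex.I)‖ =
      (2 * Real.pi) ^ n * ‖w z‖ := by
  have hpi := Real.two_pi_pos
  have hF : Integrable (FourierTransform.fourier w) := by
    refine (hW.comp_smul (R := -(2 * Real.pi)) (by simp [Real.pi_ne_zero])).congr
      (.of_forall fun ζ => ?_)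
    simp only [charTransform_eq_fourier, smul_smul, neg_mul_neg, inv_mul_cancel₀ hpi.ne', one_smul]
  have hinv : FourierTransform.fourierInv (FourierTransform.fourier w) z = w z :=
    hw.fourierInv_fourier_eq hF hc.continuousAt
  rw [Real.fourierInv_eq'] at hinv
  have h1 := Measure.integral_comp_smul (volume : Measure (E n))
    (fun ζ => Complex.exp (((2 * Real.pi * inner ℝ ζ z : ℝ) : ℂ) * Complex.I) •
      FourierTransform.fourier w ζ) (-(2 * Real.pi)⁻¹)
  rw [hinv, finrank_euclideanSpace_fin] at h1
  have h2 : (∫ k, charTransform w k * Complex.exp (((-inner ℝ k z : ℝ) : ℂ) * Complex.I)) =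
      |((-(2 * Real.pi)⁻¹) ^ n)⁻¹| • w z := by
    rw [← h1]
    refine integral_congr_ae (.of_forall fun k => ?_)
    simp only [charTransform_eq_fourier, smul_eq_mul, real_inner_smul_left]
    rw [mul_comm]
    congr 4
    field_simp
  rw [h2, norm_smul, Real.norm_eq_abs, abs_abs, ← Real.norm_eq_abs, norm_inv, norm_pow, norm_neg, norm_inv, Real.norm_of_nonneg hpi.le,
    inv_pow, inv_inv]

/-! ### The kernel estimate -/

theorem IsCutoff.integrable_charTransform {n J : ℕ} {A : ℕ → ℝ} {p : Fin J → E n} {μ : ℝ}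
    {χ : E n → ℝ} (h : IsCutoff A p μ χ) {g : E n → ℝ} (hg : Integrable g)
    (hle : ∀ k, ‖charTransform (weight χ) k‖ ≤ g k) :
    Integrable (charTransform (weight χ)) := by
  refine hg.mono' (Continuous.aestronglyMeasurable ?_) (.of_forall hle)
  have hw := h.integrable_weight
  have hc := h.contDiff_weight.continuous
  refine continuous_of_dominated (bound := fun x => ‖weight χ x‖)
    (fun k => (by fun_prop : Continuous _).aestronglyMeasurable)
    (fun k => .of_forall fun x => ?_) hw.norm (.of_forall fun x => by fun_prop)
  rw [norm_mul, Complex.norm_exp_ofReal_mul_I, mul_one]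

/-- The two bounds for the regularised kernel: one losing the number of points, the other one
gaining from the scale of the cutoff. -/
theorem exists_norm_integral_osc_mul_osc_le {n : ℕ} (hn : 3 ≤ n) (a : ℕ → ℝ) : ∃ C > 0, ∀ {J : ℕ}
    {p : Fin J → E n} {μ : ℝ} {χ : E n → ℝ}, 0 < μ → IsCutoff a p μ χ →
    ∀ {A B δ : ℝ}, 1 ≤ A → 1 ≤ B → 0 < δ → δ ≤ 1 → ∀ y z : E n,
      ‖∫ x, osc A 0 δ 0 (x - y) * osc B 0 δ 0 (x - z) * weight χ x‖ ≤
        C * (J * (A + B) ^ (-(n / 4 : ℝ))) ∧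
      ‖∫ x, osc A 0 δ 0 (x - y) * osc B 0 δ 0 (x - z) * weight χ x‖ ≤
        C * ((A + B) ^ (-(n / 4 : ℝ)) + (A + B) * J * μ) := by
  obtain ⟨C₁, hC₁, h1⟩ := exists_norm_osc_le n
  obtain ⟨C₂, hC₂, h2⟩ := exists_norm_osc_sub_le hn
  obtain ⟨C₃, hC₃, h3⟩ := exists_integral_charTransform_le n a
  have hb0 := weightBound_nonneg a 0
  have hpi := Real.two_pi_pos
  set D := C₁ * C₃ + ((2 * Real.pi) ^ n * weightBound a 0 * C₁ + C₂ * C₃) with hD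
  have hD1 : C₁ * C₃ ≤ D := by
    have : 0 ≤ (2 * Real.pi) ^ n * weightBound a 0 * C₁ + C₂ * C₃ := by positivity
    linarith
  have hD2 : (2 * Real.pi) ^ n * weightBound a 0 * C₁ ≤ D := by
    have : 0 ≤ C₁ * C₃ + C₂ * C₃ := by positivity
    linarith
  have hD3 : C₂ * C₃ ≤ D := by
    have : 0 ≤ C₁ * C₃ + (2 * Real.pi) ^ n * weightBound a 0 * C₁ := by positivity
    linarith
  refine ⟨D, by positivity, fun {J p μ χ} hμ h {A B δ} hA hB hδ hδ1 y z => ?_⟩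
  obtain ⟨g, hg, hWg, hkg, hgC⟩ := h3 hμ h
  have hA0 : 0 < A := by linarith
  have hB0 : 0 < B := by linarith
  set W := charTransform (weight χ) with hWdef
  have hW : Integrable W := h.integrable_charTransform hg hWg
  rw [integral_osc_mul_osc_mul hA0 hB0 hδ hδ1 h.integrable_weight hW y z]
  set T := (A + B) ^ (-(n / 4 : ℝ)) with hT
  have hT0 : 0 ≤ T := by positivity
  have hg0 : ∀ k, 0 ≤ g k := fun k => (norm_nonneg _).trans (hWg k)
  constructor
  · calc _ ≤ ∫ k, g k * (C₁ * T) := by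
          refine norm_integral_le_of_norm_le (hg.mul_const _) (.of_forall fun k => ?_)
          rw [norm_mul, norm_mul, Complex.norm_exp_ofReal_mul_I, one_mul]
          exact mul_le_mul (hWg k) (h1 hA0 hB0.le hδ hδ1 k (z - y)) (norm_nonneg _) (hg0 k)
      _ = (∫ k, g k) * (C₁ * T) := integral_mul_const _ _
      _ ≤ (C₃ * J) * (C₁ * T) := by gcongr
      _ = C₁ * C₃ * (J * T) := by ring
      _ ≤ D * (J * T) := by gcongr
  · set e : E n → ℂ := fun k => Complex.exp (((-inner ℝ k z : ℝ) : ℂ) * Complex.I) with he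
    have hec : Continuous e := by fun_prop
    have hen : ∀ k, ‖e k‖ = 1 := fun k => Complex.norm_exp_ofReal_mul_I _
    have hosc := continuous_osc_left hA0 hB0.le hδ (z - y)
    have hWe : Integrable fun k => W k * e k :=
      hW.mul_bdd (c := 1) hec.aestronglyMeasurable (.of_forall fun k => (hen k).le)
    have hWo : Integrable fun k => W k * (e k * osc A B δ k (z - y)) :=
      hW.mul_bdd (c := C₁ * T) (hec.mul hosc).aestronglyMeasurable (.of_forall fun k => by
        rw [norm_mul, hen, one_mul]
        exact h1 hA0 hB0.le hδ hδ1 k (z - y))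
    -- Since `W` concentrates at frequencies of size `μ`, `osc` is frozen at `k = 0`; the main term
    -- is then `w(z)` by Fourier inversion and carries no factor `J`.
    have hsplit : ∫ k, W k * (e k * osc A B δ k (z - y)) =
        (∫ k, W k * e k) * osc A B δ 0 (z - y) +
          ∫ k, W k * (e k * (osc A B δ k (z - y) - osc A B δ 0 (z - y))) := by
      rw [← integral_mul_const, ← sub_eq_iff_eq_add', ← integral_sub hWo (hWe.mul_const _)]
      exact integral_congr_ae (.of_forall fun k => by ring)
    have hfirst : ‖(∫ k, W k * e k) * osc A B δ 0 (z - y)‖ ≤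
        (2 * Real.pi) ^ n * weightBound a 0 * (C₁ * T) := by
      rw [norm_mul, norm_integral_charTransform_mul h.contDiff_weight.continuous
        h.integrable_weight hW z]
      gcongr
      · exact h.norm_weight_apply_le hμ z
      · exact h1 hA0 hB0.le hδ hδ1 0 (z - y)
    have hsecond : ‖∫ k, W k * (e k * (osc A B δ k (z - y) - osc A B δ 0 (z - y)))‖ ≤
        C₂ * B * μ * (C₃ * J) := by
      calc _ ≤ ∫ k, (C₂ * B * μ) * g k := by
            refine norm_integral_le_of_norm_le (hg.const_mul _) (.of_forall fun k => ?_)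
            rw [norm_mul, norm_mul, hen, one_mul]
            calc _ ≤ ‖W k‖ * (C₂ * B * ‖k‖) := by
                  gcongr
                  exact h2 hA0 hB hδ hδ1 k (z - y)
              _ = C₂ * B * (‖k‖ * ‖W k‖) := by ring
              _ ≤ C₂ * B * (μ * g k) := mul_le_mul_of_nonneg_left (hkg k) (by positivity)
              _ = _ := by ring
        _ = (C₂ * B * μ) * ∫ k, g k := integral_const_mul _ _
        _ ≤ _ := by gcongr
    rw [hsplit]
    calc _ ≤ (2 * Real.pi) ^ n * weightBound a 0 * (C₁ * T) + C₂ * B * μ * (C₃ * J) :=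
          (norm_add_le _ _).trans (add_le_add hfirst hsecond)
      _ = (2 * Real.pi) ^ n * weightBound a 0 * C₁ * T + C₂ * C₃ * (B * J * μ) := by ring
      _ ≤ D * T + D * ((A + B) * J * μ) := by
          gcongr
          linarith
      _ = _ := by ring

theorem exists_norm_fundSol_le (n : ℕ) : ∃ C > 0, ∀ x : E n, ‖fundSol x‖ ≤ C := by
  obtain ⟨C, hC, h⟩ := exists_norm_rotatedSol_le n
  exact ⟨C, hC, fun x => fundSol_eq_rotatedSol x ▸ h x⟩

theorem IsCutoff.integrable_kernelIntegrand {n J : ℕ} {A : ℕ → ℝ} {p : Fin J → E n} {μ : ℝ}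
    {χ : E n → ℝ} (h : IsCutoff A p μ χ) (t' t'' t₀ : ℝ) (y z : E n) :
    Integrable (kernelIntegrand χ t' t'' t₀ y z) := by
  obtain ⟨C, hC, hb⟩ := exists_norm_fundSol_le n
  have hf := continuous_fundSol (n := n)
  refine h.integrable_weight.bdd_mul (c := C * C)
    (f := fun x => fundSol (((t₀ - t') ^ (1 / 4 : ℝ))⁻¹ • (x - y)) *
      fundSol (((t'' - t₀) ^ (1 / 4 : ℝ))⁻¹ • (x - z)))
    (by fun_prop : Continuous _).aestronglyMeasurable (.of_forall fun x => ?_)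
  rw [norm_mul]
  exact mul_le_mul (hb _) (hb _) (norm_nonneg _) hC.le

/-- A bound for the regularised kernels passes to the kernel. -/
theorem IsCutoff.norm_kernel_le {n J : ℕ} {A : ℕ → ℝ} {p : Fin J → E n} {μ : ℝ}
    {χ : E n → ℝ} (h : IsCutoff A p μ χ) {t' t'' t₀ : ℝ} (ht' : t' < t₀) (ht'' : t₀ < t'')
    (y z : E n) {b : ℝ} (hb : ∀ δ : ℝ, 0 < δ → δ ≤ 1 →
      ‖∫ x, osc (t₀ - t') 0 δ 0 (x - y) * osc (t'' - t₀) 0 δ 0 (x - z) * weight χ x‖ ≤ b) :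
    ‖kernel χ t' t'' t₀ y z‖ ≤ b := by
  obtain ⟨C, hC, hbd⟩ := exists_norm_osc_one_le n
  have root : ∀ s : ℝ, 0 < s → 0 < s ^ (1 / 4 : ℝ) ∧ (s ^ (1 / 4 : ℝ)) ^ 4 = s ∧
      (s ^ (1 / 4 : ℝ)) ^ n = s ^ ((n : ℝ) / 4) := by
    intro s hs
    refine ⟨by positivity, ?_, ?_⟩
    · rw [← Real.rpow_natCast, ← Real.rpow_mul hs.le]
      norm_num
    · rw [← Real.rpow_natCast, ← Real.rpow_mul hs.le]
      congr 1
      ring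
  obtain ⟨hr, hr4, hrn⟩ := root (t₀ - t') (sub_pos.2 ht')
  obtain ⟨hs, hs4, hsn⟩ := root (t'' - t₀) (sub_pos.2 ht'')
  set r := (t₀ - t') ^ (1 / 4 : ℝ) with hrdef
  set s := (t'' - t₀) ^ (1 / 4 : ℝ) with hsdef
  have hlim : Tendsto (fun δ => ∫ x, osc 1 0 δ 0 (r⁻¹ • (x - y)) * osc 1 0 δ 0 (s⁻¹ • (x - z)) *
      weight χ x) (𝓝[>] 0) (𝓝 (∫ x, kernelIntegrand χ t' t'' t₀ y z x)) := by
    refine tendsto_integral_filter_of_dominated_convergence (fun x => C * C * ‖weight χ x‖) ?_ ?_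
      (h.integrable_weight.norm.const_mul _) (.of_forall fun x => ?_)
    · filter_upwards [eventually_mem_Ioc_zero_one] with δ hδ
      have hc := continuous_osc_zero (n := n) one_pos hδ.1
      have hc1 := hc.comp (by fun_prop : Continuous fun x : E n => r⁻¹ • (x - y))
      have hc2 := hc.comp (by fun_prop : Continuous fun x : E n => s⁻¹ • (x - z))
      exact ((hc1.mul hc2).mul h.contDiff_weight.continuous).aestronglyMeasurable
    · filter_upwards [eventually_mem_Ioc_zero_one] with δ hδ
      refine .of_forall fun x => ?_
      rw [norm_mul, norm_mul]
      gcongr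
      · exact hbd hδ.1 hδ.2 _
      · exact hbd hδ.1 hδ.2 _
    · have := ((tendsto_osc (r⁻¹ • (x - y))).mul (tendsto_osc (s⁻¹ • (x - z)))).mul_const
        (weight χ x)
      rwa [← fundSol_eq_rotatedSol, ← fundSol_eq_rotatedSol] at this
  have hle : ‖∫ x, kernelIntegrand χ t' t'' t₀ y z x‖ ≤ r ^ n * s ^ n * b := by
    refine le_of_tendsto hlim.norm ?_
    filter_upwards [eventually_mem_Ioc_zero_one] with δ hδ
    have e : ∫ x, osc 1 0 δ 0 (r⁻¹ • (x - y)) * osc 1 0 δ 0 (s⁻¹ • (x - z)) * weight χ x =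
        ((r : ℂ) ^ n * (s : ℂ) ^ n) *
          ∫ x, osc (t₀ - t') 0 δ 0 (x - y) * osc (t'' - t₀) 0 δ 0 (x - z) * weight χ x := by
      rw [← integral_const_mul]
      refine integral_congr_ae (.of_forall fun x => ?_)
      simp only [osc_smul hr, osc_smul hs, hr4, hs4]
      ring
    rw [e, norm_mul, norm_mul, norm_pow, norm_pow, Complex.norm_real, Complex.norm_real,
      Real.norm_of_nonneg hr.le, Real.norm_of_nonneg hs.le]
    gcongr
    exact hb δ hδ.1 hδ.2
  have hrn0 : 0 < r ^ n := by positivity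
  have hsn0 : 0 < s ^ n := by positivity
  rw [kernel, norm_mul, norm_mul, Complex.norm_real, Complex.norm_real, ← hrn, ← hsn,
    Real.norm_of_nonneg (by positivity), Real.norm_of_nonneg (by positivity)]
  calc _ ≤ 1 / r ^ n * (1 / s ^ n) * (r ^ n * s ^ n * b) := by gcongr
    _ = b := by field_simp

/-- Interpolation between the two bounds for the kernel. -/
theorem min_bound_le {n : ℕ} (hn : 5 ≤ n) {T X μ κ C : ℝ} {J : ℕ} (hT : 1 ≤ T) (hμ : 0 ≤ μ)
    (hC : 0 ≤ C) (hJ : (J : ℝ) ≤ X) (hμX : X ^ 4 * μ ≤ 1)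
    (h1 : κ ≤ C * (J * T ^ (-(n / 4 : ℝ)))) (h2 : κ ≤ C * (T ^ (-(n / 4 : ℝ)) + T * J * μ)) :
    κ ≤ 2 * C * (1 / T ^ ((n : ℝ) / 8)) := by
  have hT0 : 0 < T := by linarith
  have hn' : (5 : ℝ) ≤ n := by exact_mod_cast hn
  set P := T ^ ((n : ℝ) / 8) with hP
  have hP0 : 0 < P := by positivity
  have hP1 : 1 ≤ P := Real.one_le_rpow hT (by positivity)
  have hPT : T ^ (-(n / 4 : ℝ)) = 1 / P * (1 / P) := by
    rw [hP, one_div_mul_one_div, ← Real.rpow_add hT0, Real.rpow_neg hT0.le, one_div]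
    congr 2
    ring
  -- This uses `n / 4 ≥ 1`.
  have hTP : T ≤ P ^ 2 := by
    rw [hP, ← Real.rpow_natCast, ← Real.rpow_mul hT0.le]
    calc T = T ^ (1 : ℝ) := (Real.rpow_one T).symm
      _ ≤ _ := Real.rpow_le_rpow_of_exponent_le hT (by push_cast; linarith)
  have hQ1 : 1 / P ≤ 1 := (div_le_one hP0).2 hP1
  have hQ0 : 0 < 1 / P := by positivity
  rw [hPT] at h1 h2
  rcases le_total (J : ℝ) P with hJP | hJP
  · have h3 : J * (1 / P * (1 / P)) ≤ 1 / P := by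
      calc J * (1 / P * (1 / P)) ≤ P * (1 / P * (1 / P)) := by gcongr
        _ = 1 / P := by field_simp
    nlinarith [mul_le_mul_of_nonneg_left h3 hC]
  · have h3 : 1 / P * (1 / P) ≤ 1 / P := mul_le_of_le_one_left hQ0.le hQ1
    -- Many points compared with the time span: `T ≤ P² ≤ J²`, so `TJμP ≤ J⁴μ ≤ 1`.
    have h4 : T * J * μ ≤ 1 / P := by
      rw [le_div_iff₀ hP0]
      have hJ0 : (0 : ℝ) ≤ J := by positivity
      calc T * J * μ * P ≤ P ^ 2 * J * μ * P := by gcongr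
        _ ≤ (J : ℝ) ^ 2 * J * μ * J := by gcongr
        _ = (J : ℝ) ^ 4 * μ := by ring
        _ ≤ X ^ 4 * μ := by gcongr
        _ ≤ 1 := hμX
    nlinarith [mul_le_mul_of_nonneg_left (add_le_add h3 h4) hC]

end BiharmonicKernel

/-! ### The threshold for the cutoff scale and the final estimate -/

theorem mainTheorem5 (n : ℕ) (hn : 5 ≤ n) :
    (∀ x : BiharmonicKernel.E n,
      BiharmonicKernel.IsOscillatoryIntegral (BiharmonicKernel.phase x)
        (BiharmonicKernel.fundSol x)) ∧
    ∃ c : ℝ, 0 < c ∧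
      ∀ A : ℕ → ℝ, ∃ C : ℝ, 0 < C ∧
        ∀ (C₀ μ₁ μ₃ : ℝ), 0 < μ₁ → μ₁ < 1 → 0 < μ₃ → μ₃ < μ₁ →
          ∃ m : ℝ, 0 < m ∧ m < μ₃ ∧
            ∀ μ₅ : ℝ, 0 < μ₅ → μ₅ ≤ m →
            ∀ (J : ℕ) (p : Fin J → BiharmonicKernel.E n), (J : ℝ) ≤ μ₃ ^ (-C₀) →
            ∀ χ : BiharmonicKernel.E n → ℝ, BiharmonicKernel.IsCutoff A p (μ₅ ^ 3) χ →
            ∀ t' t'' t₀ : ℝ, t' ≤ t₀ - μ₁⁻¹ → t₀ + μ₁⁻¹ ≤ t'' →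
            ∀ y z : BiharmonicKernel.E n, y ≠ z →
              Integrable (BiharmonicKernel.kernelIntegrand χ t' t'' t₀ y z) ∧
              ‖BiharmonicKernel.kernel χ t' t'' t₀ y z‖ ≤ C * (1 / |t' - t''| ^ c) := by
  refine ⟨BiharmonicKernel.isOscillatoryIntegral_fundSol, (n : ℝ) / 8, by positivity,
    fun A => ?_⟩
  obtain ⟨C, hC, hb⟩ := BiharmonicKernel.exists_norm_integral_osc_mul_osc_le
    (n := n) (by omega) A
  refine ⟨2 * C, by positivity, fun C₀ μ₁ μ₃ hμ₁ hμ₁1 hμ₃ hμ₃₁ => ?_⟩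
  set X : ℝ := μ₃ ^ (-C₀) with hX
  have hX0 : 0 < X := Real.rpow_pos_of_pos hμ₃ _
  -- The first entry keeps `μ₅` below `μ₃` and `1`; the second, with `μ₅³ ≤ μ₅`, gives `X⁴μ₅³ ≤ 1`.
  refine ⟨min (μ₃ / 2) ((1 + X) ^ 4)⁻¹, by positivity,
    (min_le_left _ _).trans_lt (half_lt_self hμ₃), ?_⟩
  intro μ₅ hμ₅ hμ₅m J p hJ χ hχ t' t'' t₀ ht' ht'' y z _
  refine ⟨hχ.integrable_kernelIntegrand t' t'' t₀ y z, ?_⟩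
  have hinv : 1 ≤ μ₁⁻¹ := (one_le_inv₀ hμ₁).2 hμ₁1.le
  have hA : 1 ≤ t₀ - t' := by linarith
  have hB : 1 ≤ t'' - t₀ := by linarith
  have habs : |t' - t''| = t₀ - t' + (t'' - t₀) := by
    rw [abs_sub_comm, abs_of_nonneg (by linarith)]
    ring
  have hμ : 0 < μ₅ ^ 3 := by positivity
  have hμ₅1 : μ₅ ≤ 1 := by linarith [hμ₅m.trans (min_le_left _ _)]
  have hsmall : X ^ 4 * μ₅ ^ 3 ≤ 1 := by
    calc X ^ 4 * μ₅ ^ 3 ≤ (1 + X) ^ 4 * ((1 + X) ^ 4)⁻¹ := by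
          gcongr
          · linarith
          · exact (pow_le_of_le_one hμ₅.le hμ₅1 (by norm_num)).trans
              (hμ₅m.trans (min_le_right _ _))
      _ = 1 := mul_inv_cancel₀ (by positivity)
  rw [habs]
  exact BiharmonicKernel.min_bound_le hn (by linarith) hμ.le hC.le hJ hsmall
    (hχ.norm_kernel_le (by linarith) (by linarith) y z fun δ hδ hδ1 =>
      (hb hμ hχ hA hB hδ hδ1 y z).1)
    (hχ.norm_kernel_le (by linarith) (by linarith) y z fun δ hδ hδ1 =>
      (hb hμ hχ hA hB hδ hδ1 y z).2)
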